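/- **Setting.** A monopolist sells $n$ goods to a buyer. The buyer first learns $\gamma\in\Gamma=[\underline\gamma,\overline\gamma]$, $\underline\gamma<\overline\gamma$, which has a density $g>0$ on $\Gamma$ and distribution function $G$, and later his valuations $\theta\in\Theta=\prod_j[\underline\theta^j,\overline\theta^j]\subset\mathbb R^n$, $\underline\theta^j<\overline\theta^j$, which given $\gamma$ have distribution function $F(\cdot|\gamma)$ and density $f(\theta|\gamma)$; $f$ is $C^1$ on $\Gamma\times\Theta$ and positive for interior $\theta$. Let $F^j,f^j$ be the marginal distribution functions and densities, $F^j_\gamma=\partial F^j/\partial\gamma$, and $$\phi^j(\gamma,\theta^j)=\theta^j+\frac{F^j_\gamma(\theta^j|\gamma)}{f^j(\theta^j|\gamma)}\,\frac{1-G(\gamma)}{g(\gamma)} .$$ Assume regularity: for every $j$, $F^j_\gamma\le 0$, and $\phi^j$ is (weakly) increasing in $\gamma$ and single-crossing in $\theta^j$ (once nonnegative, it stays nonnegative as $\theta^j$ increases). $F$ has *invariant dependencies* if its copula density does not depend on $\gamma$: there is one function $c$ with $f(\theta|\gamma)=c\big(F^1(\theta^1|\gamma),\dots,F^n(\theta^n|\gamma)\big)\prod_j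 f^j(\theta^j|\gamma)$ for all $\gamma$ and all interior $\theta$. *Original problem.* Choose measurable $q:\Gamma\times\Theta\to[0,1]^n$, $t_1:\Gamma\to\mathbb R$, $t_2:\Gamma\times\Theta\to\mathbb R$ to maximize $\mathbb E_{\gamma,\theta}[t_1(\gamma)+t_2(\gamma,\theta)]$ subject to, for all $\gamma$: (IC1) $\gamma$ maximizes $\gamma'\mapsto\mathbb E_{\theta|\gamma}\big[\max_{\theta'}\{q(\gamma',\theta')\cdot\theta-t_1(\gamma')-t_2(\gamma',\theta')\}\big]$; (IC2) every $\theta\in\Theta$ maximizes $\theta'\mapsto q(\gamma,\theta')\cdot\theta-t_2(\gamma,\theta')$; (IR) $U(\gamma):=\mathbb E_{\theta|\gamma}[q(\gamma,\theta)\cdot\theta-t_1(\gamma)-t_2(\gamma,\theta)]\ge0$. *Relaxed problem.* Let $v:\Gamma\times[0,1]^n\to\Theta$ be measurable with $v(\gamma,z)\sim F(\cdot|\gamma)$ for $z\sim U([0,1]^n)$, and suppose that for $\gamma\in\Gamma$, $z\in(0,1)^n$ either $v^k(\gamma,z)=(F^k)^{-1}(z^k|v^1(\gamma,z),\dots,v^{k-1}(\gamma,z),\gamma)$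 for all $k$ (successive conditional quantiles), or $v$ is of copula form: the percentiles $F^j(v^j(\gamma,z)|\gamma)$ depend on $\gamma$ only through the copula of $F(\cdot|\gamma)$. The shock $z$ is publicly observed, and the monopolist chooses measurable $\hat q:\Gamma\times[0,1]^n\to[0,1]^n$, $\hat t:\Gamma\to\mathbb R$ to maximize $\mathbb E_\gamma[\hat t(\gamma)]$ subject to, for all $\gamma$: (IC$'$) $\gamma$ maximizes $\gamma'\mapsto\mathbb E_z[\hat q(\gamma',z)\cdot v(\gamma,z)]-\hat t(\gamma')$; (IR$'$) $\hat U(\gamma):=\mathbb E_z[\hat q(\gamma,z)\cdot v(\gamma,z)]-\hat t(\gamma)\ge0$. A mechanism $(q,t_1,t_2)$ of the original problem *induces* $\hat q(\gamma,z)=q(\gamma,v(\gamma,z))$, $\hat t(\gamma)=\mathbb E_z[t_1(\gamma)+t_2(\gamma,v(\gamma,z))]$. **Proposition.** Suppose $F$ has invariant dependencies. Then the solution of the original problem coincides with the solution of the relaxed problem. Precisely: 1. If $\theta=v(\gamma,z)$ is interior, $z\in(0,1)^n$, then $v^j_\gamma(\gamma,z)$ exists (one-sided at the ends of $\Gamma$)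 and equals $-F^j_\gamma(\theta^j|\gamma)/f^j(\theta^j|\gamma)$. 2. Feasible mechanisms of the original problem have profit $\mathbb E_{\gamma,\theta}\big[\sum_j q^j(\gamma,\theta)\phi^j(\gamma,\theta^j)\big]-U(\underline\gamma)$. Those of the relaxed problem have profit $\mathbb E_{\gamma,z}\big[\hat q(\gamma,z)\cdot\big(v(\gamma,z)-v_\gamma(\gamma,z)\tfrac{1-G(\gamma)}{g(\gamma)}\big)\big]-\hat U(\underline\gamma)$. For every measurable $q:\Gamma\times\Theta\to[0,1]^n$ the two expectations agree when $\hat q(\gamma,z)=q(\gamma,v(\gamma,z))$. 3. There is a solution $(q,t_1,t_2)$ of the original problem whose induced mechanism solves the relaxed problem and which maximizes pointwise: for interior $\theta$, $q^j(\gamma,\theta)=1$ if $\phi^j(\gamma,\theta^j)\ge0$ and $q^j(\gamma,\theta)=0$ otherwise. 4. Every feasible mechanism of the original problem has the same profit as the relaxed mechanism it induces, and it solves the original problem if and only if the induced mechanism solves the relaxed problem. 5. If $(q,t_1,t_2)$ solves the original and $(\hat q,\hat t)$ the relaxed problem, then their profits are equal and, for almost all $(\gamma,z)$ and all $j$ with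 $\phi^j(\gamma,v^j(\gamma,z))\ne0$, $\hat q^j(\gamma,z)=q^j(\gamma,v(\gamma,z))$. If moreover almost surely $\phi^j(\gamma,\theta^j)\neq0$ for all $j$, then for almost all $\gamma$ both $\hat q(\gamma,z)=q(\gamma,v(\gamma,z))$ for almost all $z$, and $\hat t(\gamma)=\mathbb E_z[t_1(\gamma)+t_2(\gamma,v(\gamma,z))]$. -/

import Mathlib

open MeasureTheory Set
open scoped Matrix

noncomputable section

namespace Screening

/-- The primitives. The buyer's pre-contractual type `γ` lies in `Γ = [lo, hi]` and has density `g`;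
given `γ`, the valuations `θ` lie in the box `Θ = ∏ⱼ [a j, b j]` and have density `f γ`, which is
continuously differentiable in `(γ, θ)`.  Both densities are positive where one divides by them
(the boundary of `Θ` is exempt). -/
structure Env (n : ℕ) where
  lo : ℝ
  hi : ℝ
  lo_lt_hi : lo < hi
  a : Fin n → ℝ
  b : Fin n → ℝ
  a_lt_b : ∀ j, a j < b j
  g : ℝ → ℝ
  g_pos : ∀ γ ∈ Icc lo hi, 0 < g γ
  g_integral : ∫ γ in Icc lo hi, g γ = 1
  f : ℝ → (Fin n → ℝ) → ℝ
  f_contDiff : ContDiffOn ℝ 1 (fun p : ℝ × (Fin n → ℝ) => f p.1 p.2) (Icc lo hi ×ˢ Icc a b)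
  f_pos : ∀ γ ∈ Icc lo hi, ∀ θ : Fin n → ℝ, (∀ j, θ j ∈ Ioo (a j) (b j)) → 0 < f γ θ
  f_integral : ∀ γ ∈ Icc lo hi, ∫ θ in Icc a b, f γ θ = 1

/-- The open unit cube `(0,1)ⁿ`. -/
def openCube (n : ℕ) : Set (Fin n → ℝ) := {z | ∀ j, z j ∈ Ioo (0 : ℝ) 1}

/-- The uniform distribution on `[0,1]ⁿ`. -/
def unif (n : ℕ) : Measure (Fin n → ℝ) := volume.restrict (Icc 0 1)

/-- A mechanism `(q, t₁, t₂)`; only its values at `γ ∈ Γ`, `θ ∈ Θ` matter. -/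
structure Mechanism (n : ℕ) where
  q : ℝ → (Fin n → ℝ) → (Fin n → ℝ)
  t₁ : ℝ → ℝ
  t₂ : ℝ → (Fin n → ℝ) → ℝ

/-- A mechanism `(q̂, t̂)` for the problem in which `z` is publicly observed. -/
structure RelaxedMechanism (n : ℕ) where
  q : ℝ → (Fin n → ℝ) → (Fin n → ℝ)
  t : ℝ → ℝ

namespace Env

variable {n : ℕ} (E : Env n)

/-- The interval of pre-contractual types. -/
def Γ : Set ℝ := Icc E.lo E.hi

/-- The box of valuations. -/
def Θ : Set (Fin n → ℝ) := Icc E.a E.b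

/-- The open box of interior valuations. -/
def Θint : Set (Fin n → ℝ) := {θ | ∀ j, θ j ∈ Ioo (E.a j) (E.b j)}

/-! ### Distributions -/

/-- The law of `γ`. -/
def prior : Measure ℝ := (volume.restrict E.Γ).withDensity fun γ => ENNReal.ofReal (E.g γ)

/-- The distribution function of `γ`. -/
def G (γ : ℝ) : ℝ := E.prior.real (Iic γ)

/-- The density `f(·|γ)`, extended by zero outside `Θ`. -/
def dens (γ : ℝ) : (Fin n → ℝ) → ENNReal :=
  E.Θ.indicator fun θ => ENNReal.ofReal (E.f γ θ)

/-- The law of `θ` given `γ`. -/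
def law (γ : ℝ) : Measure (Fin n → ℝ) := volume.withDensity (E.dens γ)

/-- The marginal distribution function `Fʲ(x|γ)`. -/
def margCdf (j : Fin n) (γ x : ℝ) : ℝ := (E.law γ).real {θ | θ j ≤ x}

/-- The marginal density `fʲ(x|γ)`: all coordinates but the `j`th are integrated out. -/
def margDens (j : Fin n) (γ x : ℝ) : ℝ :=
  (lmarginal (fun _ : Fin n => (volume : Measure ℝ)) (Finset.univ.erase j) (E.dens γ)
    (fun _ => x)).toReal

/-- `Fʲ_γ(x|γ)`, the derivative of the marginal distribution function in `γ` (one-sided at the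
ends of `Γ`). -/
def margCdfDeriv (j : Fin n) (γ x : ℝ) : ℝ :=
  derivWithin (fun s => E.margCdf j s x) E.Γ γ

/-- The conditional distribution function `Fᵏ(x | θ¹, …, θᵏ⁻¹, γ)`: with the coordinates before `k`
fixed at `θ`, the coordinates from `k` on are integrated out. -/
def condCdf (k : Fin n) (γ : ℝ) (θ : Fin n → ℝ) (x : ℝ) : ℝ :=
  (lmarginal (fun _ : Fin n => (volume : Measure ℝ)) (Finset.Ici k)
      ({y : Fin n → ℝ | y k ≤ x}.indicator (E.dens γ)) θ).toReal /
    (lmarginal (fun _ : Fin n => (volume : Measure ℝ)) (Finset.Ici k) (E.dens γ) θ).toReal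

/-- The virtual value `φʲ(γ, x) = x + (Fʲ_γ(x|γ) / fʲ(x|γ)) * (1 - G(γ)) / g(γ)`. -/
def virtualValue (j : Fin n) (γ x : ℝ) : ℝ :=
  x + E.margCdfDeriv j γ x / E.margDens j γ x * ((1 - E.G γ) / E.g γ)

/-- Marginal-by-marginal regularity: `Fʲ_γ ≤ 0`, and the virtual value is (weakly) increasing in `γ`
and single-crossing in `θʲ` (once nonnegative, it stays nonnegative). -/
structure Regular : Prop where
  margCdfDeriv_nonpos : ∀ j, ∀ γ ∈ E.Γ, ∀ x ∈ Ioo (E.a j) (E.b j), E.margCdfDeriv j γ x ≤ 0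
  monotone : ∀ j, ∀ x ∈ Ioo (E.a j) (E.b j), MonotoneOn (fun γ => E.virtualValue j γ x) E.Γ
  singleCrossing : ∀ j, ∀ γ ∈ E.Γ, ∀ x ∈ Ioo (E.a j) (E.b j), ∀ y ∈ Ioo (E.a j) (E.b j),
    x ≤ y → 0 ≤ E.virtualValue j γ x → 0 ≤ E.virtualValue j γ y

/-- `c` is the copula density of `F(·|γ)`:
`f(θ|γ) = c(F¹(θ¹|γ), …, Fⁿ(θⁿ|γ)) ∏ⱼ fʲ(θʲ|γ)`. Since the percentiles of the interior valuations
fill the open unit cube and the marginal densities are positive there, this determines `c` on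
the open unit cube. -/
def IsCopulaDensity (γ : ℝ) (c : (Fin n → ℝ) → ℝ) : Prop :=
  ∀ θ ∈ E.Θint, E.f γ θ = c (fun j => E.margCdf j γ (θ j)) * ∏ j, E.margDens j γ (θ j)

/-- `F` has invariant dependencies: the copula density does not vary with `γ`. -/
def InvariantDependencies : Prop :=
  ∃ c : (Fin n → ℝ) → ℝ, ∀ γ ∈ E.Γ, E.IsCopulaDensity γ c

/-! ### Orthogonalizations -/

/-- `v` is the map of successive conditional quantiles,
`vᵏ(γ, z) = (Fᵏ)⁻¹(zᵏ | v¹(γ, z), …, vᵏ⁻¹(γ, z), γ)`. -/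
def IsConditionalQuantileMap (v : ℝ → (Fin n → ℝ) → (Fin n → ℝ)) : Prop :=
  ∀ γ ∈ E.Γ, ∀ z ∈ openCube n, ∀ k, E.condCdf k γ (v γ z) (v γ z k) = z k

/-- `v` is given by marginal quantiles of a simulated copula, `vʲ(γ, z) = (Fʲ)⁻¹(κʲ(z)|γ)`, where
the percentiles `κʲ(z) = Fʲ(vʲ(γ, z)|γ)` depend on `γ` only through the copula of `F(·|γ)`. -/
def IsCopulaMap (v : ℝ → (Fin n → ℝ) → (Fin n → ℝ)) : Prop :=
  ∀ γ ∈ E.Γ, ∀ γ' ∈ E.Γ, (∃ c, E.IsCopulaDensity γ c ∧ E.IsCopulaDensity γ' c) →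
    ∀ z ∈ openCube n, ∀ j, E.margCdf j γ (v γ z j) = E.margCdf j γ' (v γ' z j)

/-- `v : Γ × [0,1]ⁿ → Θ` represents the valuations by orthogonalized shocks, `v(γ, z) ∼ F(·|γ)` for
`z` uniform on the unit cube, either by successive conditional quantiles or through the copula. -/
structure IsOrthogonalization (v : ℝ → (Fin n → ℝ) → (Fin n → ℝ)) : Prop where
  measurable : Measurable (Function.uncurry v)
  mapsTo : ∀ γ ∈ E.Γ, ∀ z ∈ Icc (0 : Fin n → ℝ) 1, v γ z ∈ E.Θ
  map_unif : ∀ γ ∈ E.Γ, (unif n).map (v γ) = E.law γ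
  form : E.IsConditionalQuantileMap v ∨ E.IsCopulaMap v

/-! ### The original problem -/

/-- The constraints of the original problem. In `ic1` the inner supremum is the payoff of a buyer who
reported `γ'` and then optimally (mis)reports his valuations; by `ic2` it is attained. -/
structure Feasible (M : Mechanism n) : Prop where
  measurable_q : Measurable (Function.uncurry M.q)
  measurable_t₁ : Measurable M.t₁
  measurable_t₂ : Measurable (Function.uncurry M.t₂)
  q_mem : ∀ γ ∈ E.Γ, ∀ θ ∈ E.Θ, ∀ j, M.q γ θ j ∈ Icc (0 : ℝ) 1
  ic1 : ∀ γ ∈ E.Γ, ∀ γ' ∈ E.Γ,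
    ∫ θ, (⨆ θ' : E.Θ, (M.q γ' θ' ⬝ᵥ θ - M.t₁ γ' - M.t₂ γ' θ')) ∂(E.law γ) ≤
      ∫ θ, (⨆ θ' : E.Θ, (M.q γ θ' ⬝ᵥ θ - M.t₁ γ - M.t₂ γ θ')) ∂(E.law γ)
  ic2 : ∀ γ ∈ E.Γ, ∀ θ ∈ E.Θ, ∀ θ' ∈ E.Θ,
    M.q γ θ' ⬝ᵥ θ - M.t₂ γ θ' ≤ M.q γ θ ⬝ᵥ θ - M.t₂ γ θ
  ir : ∀ γ ∈ E.Γ, 0 ≤ ∫ θ, (M.q γ θ ⬝ᵥ θ - M.t₁ γ - M.t₂ γ θ) ∂(E.law γ)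

/-- Expected revenue in the original problem. -/
def profit (M : Mechanism n) : ℝ :=
  ∫ γ, ∫ θ, (M.t₁ γ + M.t₂ γ θ) ∂(E.law γ) ∂E.prior

/-- `M` solves the original problem. -/
def IsOptimal (M : Mechanism n) : Prop :=
  E.Feasible M ∧ ∀ M', E.Feasible M' → E.profit M' ≤ E.profit M

/-- The truthful buyer's expected payoff in the original problem. -/
def interimUtility (M : Mechanism n) (γ : ℝ) : ℝ :=
  ∫ θ, (M.q γ θ ⬝ᵥ θ - M.t₁ γ - M.t₂ γ θ) ∂(E.law γ)

/-- The virtual surplus `E[∑ⱼ qʲ(γ, θ) φʲ(γ, θʲ)]`. -/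
def objective (q : ℝ → (Fin n → ℝ) → (Fin n → ℝ)) : ℝ :=
  ∫ γ, ∫ θ, ∑ j, q γ θ j * E.virtualValue j γ (θ j) ∂(E.law γ) ∂E.prior

/-! ### The relaxed problem -/

/-- The constraints of the problem in which `z` is publicly observed and `θ = v(γ, z)`. -/
structure RelaxedFeasible (v : ℝ → (Fin n → ℝ) → (Fin n → ℝ)) (M : RelaxedMechanism n) :
    Prop where
  measurable_q : Measurable (Function.uncurry M.q)
  measurable_t : Measurable M.t
  q_mem : ∀ γ ∈ E.Γ, ∀ z ∈ Icc (0 : Fin n → ℝ) 1, ∀ j, M.q γ z j ∈ Icc (0 : ℝ) 1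
  ic : ∀ γ ∈ E.Γ, ∀ γ' ∈ E.Γ,
    (∫ z, M.q γ' z ⬝ᵥ v γ z ∂(unif n)) - M.t γ' ≤ (∫ z, M.q γ z ⬝ᵥ v γ z ∂(unif n)) - M.t γ
  ir : ∀ γ ∈ E.Γ, 0 ≤ (∫ z, M.q γ z ⬝ᵥ v γ z ∂(unif n)) - M.t γ

/-- Expected revenue in the relaxed problem. -/
def relaxedProfit (M : RelaxedMechanism n) : ℝ := ∫ γ, M.t γ ∂E.prior

/-- `M` solves the relaxed problem. -/
def IsRelaxedOptimal (v : ℝ → (Fin n → ℝ) → (Fin n → ℝ)) (M : RelaxedMechanism n) : Prop :=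
  E.RelaxedFeasible v M ∧ ∀ M', E.RelaxedFeasible v M' → E.relaxedProfit M' ≤ E.relaxedProfit M

/-- The virtual surplus of the relaxed problem, written with the impulse response `v_γ`:
`E[q̂(γ, z) · (v(γ, z) - v_γ(γ, z) (1 - G(γ)) / g(γ))]`. -/
def relaxedObjective (v : ℝ → (Fin n → ℝ) → (Fin n → ℝ))
    (q : ℝ → (Fin n → ℝ) → (Fin n → ℝ)) : ℝ :=
  ∫ γ, ∫ z, ∑ j, q γ z j *
    (v γ z j - derivWithin (fun s => v s z j) E.Γ γ * ((1 - E.G γ) / E.g γ)) ∂(unif n) ∂E.prior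

end Env

/-- The relaxed mechanism that a mechanism `(q, t₁, t₂)` induces:
`q̂(γ, z) = q(γ, v(γ, z))` and `t̂(γ) = E_z[t₁(γ) + t₂(γ, v(γ, z))]`. -/
def Mechanism.induced {n : ℕ} (v : ℝ → (Fin n → ℝ) → (Fin n → ℝ)) (M : Mechanism n) :
    RelaxedMechanism n where
  q γ z := M.q γ (v γ z)
  t γ := ∫ z, (M.t₁ γ + M.t₂ γ (v γ z)) ∂(unif n)

end Screening

end

/-!
Why the two problems have the same solution.

*Invariance.* Fix a shock `z`. Under invariant dependencies the density at `γ` is the pullback of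
the density at `γ'` under the increasing maps that match the marginals coordinate by coordinate
(`f_eq_transport`). Such maps preserve conditional percentiles (`condCdf_transport`), so in either
form of the orthogonalization the marginal percentiles of `v(γ, z)` do not depend on `γ`
(`percentile_eq`). Hence each `vʲ(·, z)` is a quantile curve of the `j`th marginal alone, with
derivative `-Fʲ_γ / fʲ` (`hasDerivWithinAt_quantile`), and the virtual surplus of the relaxed
problem is that of the original one.

*Profit.* In the relaxed problem, the rent of type `γ` has slope `E_z[q̂ · v_γ]`. The impulse
response `v_γ` may be unbounded near the boundary of `Θ`, so one cannot differentiate under the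
integral by a crude bound. Instead, `v` is increasing in `γ` because `Fʲ_γ ≤ 0`, and its mean is
continuously differentiable; nonnegative difference quotients whose integrals converge, converge
in `L¹` (`tendsto_integral_mul_of_nonneg`, `hasDerivWithinAt_integral_valuation`). The means also
give a Lipschitz bound for the rent, and `envelope_formula` applies. Fubini's theorem turns rents
into inverse hazard rates. A feasible mechanism of the original problem induces a feasible relaxed
mechanism with equal profit (`Feasible.relaxedFeasible_induced`), so it inherits the profit
formula.

*Optimum.* The virtual surplus is maximized pointwise by selling good `j` if and only if `φʲ ≥ 0`.
By single crossing this is a posted price, and by monotonicity the price falls in `γ`. Prices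
falling in `γ` and `Fʲ_γ ≤ 0` make the menu of posted prices, with entrance fees that implement
the envelope rents, incentive compatible in the original problem (`feasible_posted`). So the upper
bound from the relaxed problem is attained in the original one. Any other solution must attain the
pointwise maximum almost everywhere and leave no rent to the lowest type, which gives uniqueness
up to ties; the envelope formula then pins down the transfers.
-/

noncomputable section

namespace Screening

open Filter Topology

/-! ### Analytic preliminaries -/

/-- A form of Scheffé's lemma: for nonnegative functions, pointwise convergence together with
convergence of the integrals is convergence in `L¹`, so bounded multipliers may be inserted. -/
theorem tendsto_integral_mul_of_nonneg {α ι : Type*} [MeasurableSpace α] {μ : Measure α}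
    {l : Filter ι} [l.IsCountablyGenerated] {F : ι → α → ℝ} {f q : α → ℝ}
    (hF : ∀ᶠ i in l, Integrable (F i) μ) (hF0 : ∀ᶠ i in l, ∀ᵐ x ∂μ, 0 ≤ F i x)
    (hf : Integrable f μ) (hlim : ∀ᵐ x ∂μ, Tendsto (fun i => F i x) l (𝓝 (f x)))
    (hint : Tendsto (fun i => ∫ x, F i x ∂μ) l (𝓝 (∫ x, f x ∂μ)))
    (hq : AEStronglyMeasurable q μ) (hq1 : ∀ᵐ x ∂μ, ‖q x‖ ≤ 1) :
    Tendsto (fun i => ∫ x, q x * F i x ∂μ) l (𝓝 (∫ x, q x * f x ∂μ)) := by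
  have hpos : Tendsto (fun i => ∫ x, max (f x - F i x) 0 ∂μ) l (𝓝 (∫ _, (0 : ℝ) ∂μ)) := by
    refine tendsto_integral_filter_of_dominated_convergence (fun x => ‖f x‖) ?_ ?_ hf.norm ?_
    · filter_upwards [hF] with i hi
      exact ((hf.sub hi).sup (integrable_zero _ _ _)).aestronglyMeasurable
    · filter_upwards [hF0] with i hi
      filter_upwards [hi] with x hx
      rw [Real.norm_of_nonneg (le_max_right _ _)]
      exact max_le ((sub_le_self _ hx).trans (le_abs_self _)) (norm_nonneg _)
    · filter_upwards [hlim] with x hx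
      have h : Tendsto (fun i => max (f x - F i x) 0) l (𝓝 (max (f x - f x) 0)) :=
        (tendsto_const_nhds.sub hx).max tendsto_const_nhds
      simpa using h
  have habs : Tendsto (fun i => ∫ x, |F i x - f x| ∂μ) l (𝓝 0) := by
    have h := (hint.sub_const (∫ x, f x ∂μ)).add (hpos.const_mul 2)
    simp only [integral_zero, mul_zero, sub_self, add_zero] at h
    refine h.congr' ?_
    filter_upwards [hF] with i hi
    have hm : Integrable (fun x => max (f x - F i x) 0) μ := (hf.sub hi).sup (integrable_zero _ _ _)
    have hd : Integrable (fun x => F i x - f x) μ := hi.sub hf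
    rw [← integral_sub hi hf, ← integral_const_mul, ← integral_add hd (hm.const_mul 2)]
    refine integral_congr_ae (.of_forall fun x => ?_)
    rcases le_total (F i x) (f x) with h | h
    · simp only [max_eq_left (sub_nonneg.2 h), abs_of_nonpos (sub_nonpos.2 h)]; ring
    · simp only [max_eq_right (sub_nonpos.2 h), abs_of_nonneg (sub_nonneg.2 h)]; ring
  rw [tendsto_iff_norm_sub_tendsto_zero]
  refine tendsto_of_tendsto_of_tendsto_of_le_of_le' tendsto_const_nhds habs
    (.of_forall fun _ => norm_nonneg _) ?_
  filter_upwards [hF] with i hi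
  rw [← integral_sub (hi.bdd_mul hq hq1) (hf.bdd_mul hq hq1)]
  refine (norm_integral_le_integral_norm _).trans (integral_mono_ae ?_ (hi.sub hf).abs ?_)
  · exact ((hi.bdd_mul hq hq1).sub (hf.bdd_mul hq hq1)).norm
  · filter_upwards [hq1] with x hx
    rw [← mul_sub, norm_mul]
    exact mul_le_of_le_one_left (norm_nonneg _) hx

/-- Derivative of a quantile. The point `x s` is defined by `∫ₐ^{x s} p(s, y) dy = ψ s`, where
`p` is a continuous family of densities that are positive on `(a, b)`. Both the level `ψ` and
the distribution function may move with `s`. -/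
theorem hasDerivWithinAt_quantile {S : Set ℝ} {γ a b : ℝ} (hγ : γ ∈ S) {p : ℝ → ℝ → ℝ}
    (hp : Continuous (Function.uncurry p)) (hpos : ∀ s ∈ S, ∀ y ∈ Ioo a b, 0 < p s y)
    {x ψ : ℝ → ℝ} {ψ' H : ℝ} (hx : ∀ s ∈ S, x s ∈ Ioo a b)
    (heq : ∀ s ∈ S, ∫ y in a..x s, p s y = ψ s) (hψ : HasDerivWithinAt ψ ψ' S γ)
    (hF : HasDerivWithinAt (fun s => ∫ y in a..x γ, p s y) H S γ) :
    HasDerivWithinAt x ((ψ' - H) / p γ (x γ)) S γ := by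
  have hpc : ∀ s, Continuous (p s) := fun s => hp.uncurry_left s
  have hii : ∀ s c d, IntervalIntegrable (p s) volume c d :=
    fun s c d => (hpc s).intervalIntegrable _ _
  have hlt : ∀ s ∈ S, ∀ u v, a ≤ u → u < v → v ≤ b → ∫ y in a..u, p s y < ∫ y in a..v, p s y := by
    intro s hs u w hu huw hw
    rw [← sub_pos, intervalIntegral.integral_interval_sub_left (hii s _ _) (hii s _ _)]
    exact intervalIntegral.intervalIntegral_pos_of_pos_on (hii s _ _)
      (fun y hy => hpos s hs y ⟨hu.trans_lt hy.1, hy.2.trans_le hw⟩) huw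
  have hcont : ∀ u, Continuous fun s => ∫ y in a..u, p s y := fun u =>
    intervalIntegral.continuous_parametric_intervalIntegral_of_continuous' hp a u
  -- the quantile is continuous: the distribution functions converge on either side of it
  have hxc : ContinuousWithinAt x S γ := by
    have hγx := hx γ hγ
    refine tendsto_order.2 ⟨fun u hu => ?_, fun u hu => ?_⟩
    · have hu' : max u a < x γ := max_lt hu hγx.1
      obtain ⟨w, hw1, hw2⟩ := exists_between hu'
      have h1 : ∫ y in a..w, p γ y < ψ γ := by
        rw [← heq γ hγ]
        exact hlt γ hγ w _ ((le_max_right _ _).trans hw1.le) hw2 hγx.2.le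
      filter_upwards [(hcont w).continuousWithinAt.eventually_lt hψ.continuousWithinAt h1,
        self_mem_nhdsWithin] with s hs hsS
      by_contra! hle
      rw [← heq s hsS] at hs
      have hxw : x s < w := hle.trans_lt ((le_max_left _ _).trans_lt hw1)
      exact absurd hs (hlt s hsS _ _ (hx s hsS).1.le hxw (hw2.trans hγx.2).le).not_gt
    · have hu' : x γ < min u b := lt_min hu hγx.2
      obtain ⟨w, hw1, hw2⟩ := exists_between hu'
      have h1 : ψ γ < ∫ y in a..w, p γ y := by
        rw [← heq γ hγ]
        exact hlt γ hγ _ w hγx.1.le hw1 (hw2.le.trans (min_le_right _ _))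
      filter_upwards [hψ.continuousWithinAt.eventually_lt (hcont w).continuousWithinAt h1,
        self_mem_nhdsWithin] with s hs hsS
      by_contra! hle
      rw [← heq s hsS] at hs
      have hxw : w < x s := (hw2.trans_le (min_le_left _ _)).trans_le hle
      exact absurd hs (hlt s hsS _ _ (hγx.1.trans hw1).le hxw (hx s hsS).2.le).not_gt
  -- the mean density between `x γ` and `x s` is the difference quotient in the second variable
  set ν : ℝ → ℝ := fun s => ∫ t in (0 : ℝ)..1, p s (x γ + (x s - x γ) * t) with hν
  have hνc : ContinuousWithinAt ν S γ := by
    have h : Continuous fun w : ℝ × ℝ => ∫ t in (0 : ℝ)..1, p w.1 (x γ + w.2 * t) :=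
      intervalIntegral.continuous_parametric_intervalIntegral_of_continuous'
        (by change Continuous fun z : (ℝ × ℝ) × ℝ => Function.uncurry p (z.1.1, x γ + z.1.2 * z.2)
            fun_prop) 0 1
    exact h.continuousAt.comp_continuousWithinAt (f := fun s => (s, x s - x γ))
      (continuousWithinAt_id.prodMk (hxc.sub continuousWithinAt_const))
  have hνγ : ν γ = p γ (x γ) := by simp [hν]
  have hνpos : 0 < ν γ := hνγ ▸ hpos γ hγ _ (hx γ hγ)
  have hkey : ∀ s ∈ S, (x s - x γ) * ν s = (ψ s - ψ γ) -
      ((∫ y in a..x γ, p s y) - ∫ y in a..x γ, p γ y) := by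
    intro s hs
    have h1 := intervalIntegral.smul_integral_comp_add_mul (a := 0) (b := 1) (p s) (x s - x γ) (x γ)
    rw [smul_eq_mul] at h1
    rw [hν, h1, ← heq s hs, ← heq γ hγ]
    simp only [mul_zero, add_zero, mul_one, add_sub_cancel]
    rw [← intervalIntegral.integral_interval_sub_left (hii s a _) (hii s a _)]
    ring
  rw [hasDerivWithinAt_iff_tendsto_slope] at hψ hF ⊢
  have hlim := (hψ.sub hF).div (hνc.mono sdiff_subset) hνpos.ne'
  rw [hνγ] at hlim
  refine hlim.congr' ?_
  filter_upwards [(hνc.mono (sdiff_subset (t := {γ}))).eventually_ne hνpos.ne',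
    self_mem_nhdsWithin] with s hs hsS
  have := hkey s hsS.1
  have hne : s - γ ≠ 0 := sub_ne_zero.2 hsS.2
  simp only [slope_def_field, Pi.div_apply]
  rw [div_sub_div_same, ← this]
  field_simp

/-- Change of variables for iterated integrals: if the density `D` is the pullback of `D'` under
increasing maps `T j` of the single coordinates, so are its iterated integrals over any subset of
the coordinates. -/
theorem lmarginal_eq_of_coordinatewise {ι : Type*} [DecidableEq ι] [Fintype ι] {a b : ι → ℝ}
    {D D' : (ι → ℝ) → ENNReal} (hD : Measurable D) (hD' : Measurable D')
    (hD0 : ∀ θ, ∀ j, θ j ∉ Icc (a j) (b j) → D θ = 0)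
    (hD0' : ∀ θ, ∀ j, θ j ∉ Icc (a j) (b j) → D' θ = 0)
    {T r : ι → ℝ → ℝ} (hT : ∀ j, BijOn (T j) (Ioo (a j) (b j)) (Ioo (a j) (b j)))
    (hTd : ∀ j, ∀ x ∈ Ioo (a j) (b j), HasDerivWithinAt (T j) (r j x) (Ioo (a j) (b j)) x)
    (hr : ∀ j, ∀ x ∈ Ioo (a j) (b j), 0 < r j x)
    (h : ∀ θ, (∀ j, θ j ∈ Ioo (a j) (b j)) →
      D θ = (∏ j, ENNReal.ofReal (r j (θ j))) * D' fun j => T j (θ j)) (s : Finset ι) :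
    ∀ θ, (∀ j ∉ s, θ j ∈ Ioo (a j) (b j)) →
      lmarginal (fun _ => volume) s D θ = (∏ j ∈ sᶜ, ENNReal.ofReal (r j (θ j))) *
        lmarginal (fun _ => volume) s D' fun j => T j (θ j) := by
  induction s using Finset.induction_on with
  | empty => intro θ hθ; simpa using h θ (by simpa using hθ)
  | insert i s hi ih =>
    intro θ hθ
    have hind : ∀ {A : (ι → ℝ) → ENNReal}, Measurable A →
        (∀ θ, ∀ j, θ j ∉ Icc (a j) (b j) → A θ = 0) → ∀ θ,
        lmarginal (fun _ => volume) (insert i s) A θ = ∫⁻ x in Ioo (a i) (b i),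
          lmarginal (fun _ => volume) s A (Function.update θ i x) := by
      intro A hA hA0 θ
      rw [lmarginal_insert _ hA hi, restrict_Ioo_eq_restrict_Icc]
      refine (setLIntegral_eq_of_support_subset ?_).symm
      intro x hx
      by_contra hxm
      refine hx ?_
      refine (lintegral_congr fun y => hA0 _ i ?_).trans lintegral_zero
      simpa [Function.updateFinset, hi] using hxm
    have himage : ∀ g : ℝ → ENNReal, ∫⁻ x in Ioo (a i) (b i), g x =
        ∫⁻ x in Ioo (a i) (b i), ENNReal.ofReal |r i x| * g (T i x) := by
      intro g
      rw [← lintegral_image_eq_lintegral_abs_deriv_mul measurableSet_Ioo (hTd i) (hT i).injOn,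
        (hT i).image_eq]
    rw [hind hD hD0, hind hD' hD0', himage fun x => lmarginal _ s D' _,
      ← lintegral_const_mul' _ _ (ENNReal.prod_ne_top fun _ _ => ENNReal.ofReal_ne_top)]
    refine setLIntegral_congr_fun measurableSet_Ioo fun x hx => ?_
    have hupd : (fun j => T j (Function.update θ i x j)) =
        Function.update (fun j => T j (θ j)) i (T i x) := by
      ext j
      rcases eq_or_ne j i with rfl | hj
      · simp
      · simp [hj]
    have hcompl : sᶜ = insert i (insert i s)ᶜ := by
      ext j
      rcases eq_or_ne j i with rfl | hj
      · simp [hi]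
      · simp [hj]
    rw [ih (Function.update θ i x), hupd, hcompl, Finset.prod_insert (by simp),
      abs_of_pos (hr i x hx), Function.update_self]
    · rw [Finset.prod_congr rfl fun j hj => ?_, mul_assoc, mul_left_comm]
      have : j ≠ i := by rintro rfl; simp at hj
      rw [Function.update_of_ne this]
    · intro j hj
      rcases eq_or_ne j i with rfl | hji
      · simpa using hx
      · rw [Function.update_of_ne hji]; exact hθ j (by simp [hj, hji])

/-- Fubini's theorem for a continuous integrand on a compact set and an interval. -/
theorem integral_intervalIntegral_swap {Y : Type*} [TopologicalSpace Y] [MeasurableSpace Y]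
    [T2Space Y] [SecondCountableTopology Y] [OpensMeasurableSpace Y]
    {μ : Measure Y} [IsFiniteMeasureOnCompacts μ] [SFinite μ]
    {h : ℝ → Y → ℝ} (hc : Continuous (Function.uncurry h)) {K : Set Y} (hK : IsCompact K)
    (c d : ℝ) :
    ∫ y in K, (∫ s in c..d, h s y) ∂μ = ∫ s in c..d, (∫ y in K, h s y ∂μ) := by
  refine (intervalIntegral_integral_swap ?_).symm
  rw [Measure.prod_restrict]
  have := hc.continuousOn.integrableOn_compact (μ := volume.prod μ)
    ((isCompact_uIcc (a := c) (b := d)).prod hK)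
  exact this.mono_set (prod_mono uIoc_subset_uIcc le_rfl)

/-! ### The envelope formula -/

/-- An integral envelope formula. Here `U γ` is the indirect utility of type `γ`, and `L γ' γ` the
gross payoff of type `γ` from the allocation meant for `γ'`. No regularity of `L` in the report is
needed: a Lipschitz bound in the type makes `U` Lipschitz, hence the integral of its derivative. -/
theorem envelope_formula {lo hi K : ℝ} (hlh : lo < hi) {U m : ℝ → ℝ} {L : ℝ → ℝ → ℝ}
    (hIC : ∀ γ ∈ Icc lo hi, ∀ γ' ∈ Icc lo hi, U γ' + (L γ' γ - L γ' γ') ≤ U γ)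
    (hLip : ∀ γ ∈ Icc lo hi, ∀ s ∈ Icc lo hi, ∀ s' ∈ Icc lo hi,
      |L γ s - L γ s'| ≤ K * |s - s'|)
    (hd : ∀ γ ∈ Icc lo hi, HasDerivWithinAt (L γ) (m γ) (Icc lo hi) γ) :
    IntegrableOn m (Icc lo hi) ∧ ∀ γ ∈ Icc lo hi, U γ = U lo + ∫ s in lo..γ, m s := by
  have hU : LipschitzOnWith (Real.toNNReal K) U (Icc lo hi) := by
    refine LipschitzOnWith.of_dist_le_mul fun x hx y hy => ?_
    rw [Real.dist_eq, Real.dist_eq]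
    refine le_trans ?_ (mul_le_mul_of_nonneg_right (Real.le_coe_toNNReal K) (abs_nonneg _))
    have h1 := hIC x hx y hy
    have h2 := hIC y hy x hx
    have h3 := abs_le.1 (hLip x hx x hx y hy)
    have h4 := abs_le.1 (hLip y hy x hx y hy)
    exact abs_le.2 ⟨by linarith, by linarith⟩
  have hU' : LipschitzOnWith _ U (uIcc lo hi) := uIcc_of_le hlh.le ▸ hU
  have hac := hU'.absolutelyContinuousOnInterval
  have hderiv : ∀ᵐ x, x ∈ Ioc lo hi → deriv U x = m x := by
    have hne : ∀ᵐ x : ℝ, x ≠ hi := Measure.ae_ne volume hi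
    filter_upwards [hU.ae_differentiableWithinAt_of_mem (μ := volume), hne] with x hx hxne hxm
    have hx' : x ∈ Ioo lo hi := ⟨hxm.1, lt_of_le_of_ne hxm.2 hxne⟩
    have hnhds : Icc lo hi ∈ 𝓝 x := Icc_mem_nhds hx'.1 hx'.2
    have hxI : x ∈ Icc lo hi := Ioo_subset_Icc_self hx'
    have hUd := ((hx hxI).differentiableAt hnhds).hasDerivAt
    -- `U - L x` is minimal at `x`, by incentive compatibility
    have hmin : IsLocalMin (fun s => U s - L x s) x := by
      filter_upwards [hnhds] with s hs
      have := hIC s hs x hxI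
      linarith
    exact sub_eq_zero.1 (hmin.hasDerivAt_eq_zero (hUd.sub ((hd x hxI).hasDerivAt hnhds)))
  have hae : deriv U =ᵐ[volume.restrict (Ioc lo hi)] m :=
    (ae_restrict_iff' measurableSet_Ioc).2 hderiv
  have hint : IntegrableOn m (Ioc lo hi) := by
    have := hac.intervalIntegrable_deriv
    rw [intervalIntegrable_iff_integrableOn_Ioc_of_le hlh.le] at this
    exact this.congr hae
  refine ⟨(integrableOn_Icc_iff_integrableOn_Ioc (by simp)).2 hint, fun γ hγ => ?_⟩
  have hacγ : AbsolutelyContinuousOnInterval U lo γ := by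
    refine LipschitzOnWith.absolutelyContinuousOnInterval (K := Real.toNNReal K) ?_
    rw [uIcc_of_le hγ.1]
    exact hU.mono (Icc_subset_Icc_right hγ.2)
  have h1 := hacγ.integral_deriv_eq_sub
  have h2 : ∫ x in lo..γ, deriv U x = ∫ x in lo..γ, m x := by
    refine intervalIntegral.integral_congr_ae ?_
    rw [uIoc_of_le hγ.1]
    filter_upwards [hderiv] with x hx hxm using hx ⟨hxm.1, hxm.2.trans hγ.2⟩
  rw [← h2, h1]; ring

namespace Env

variable {n : ℕ} (E : Env n)

/-! ### The marginal distributions -/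

/-- The retraction of the line onto `Γ`. -/
def clipΓ (γ : ℝ) : ℝ := projIcc E.lo E.hi E.lo_lt_hi.le γ

/-- The coordinatewise retraction onto `Θ`. -/
def clipΘ (θ : Fin n → ℝ) : Fin n → ℝ := fun j => projIcc (E.a j) (E.b j) (E.a_lt_b j).le (θ j)

theorem lo_mem : E.lo ∈ E.Γ := left_mem_Icc.2 E.lo_lt_hi.le

theorem clipΓ_mem (γ : ℝ) : E.clipΓ γ ∈ E.Γ := Subtype.coe_prop _

theorem clipΓ_of_mem {γ : ℝ} (h : γ ∈ E.Γ) : E.clipΓ γ = γ := by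
  simp [clipΓ, projIcc_of_mem E.lo_lt_hi.le h]

theorem mem_Θ {θ : Fin n → ℝ} : θ ∈ E.Θ ↔ ∀ j, θ j ∈ Icc (E.a j) (E.b j) :=
  ⟨fun h j => ⟨h.1 j, h.2 j⟩, fun h => ⟨fun j => (h j).1, fun j => (h j).2⟩⟩

theorem Θint_subset_Θ : E.Θint ⊆ E.Θ := fun _ h => E.mem_Θ.2 fun j => Ioo_subset_Icc_self (h j)

theorem clipΘ_mem (θ : Fin n → ℝ) : E.clipΘ θ ∈ E.Θ := E.mem_Θ.2 fun _ => Subtype.coe_prop _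

theorem clipΘ_of_mem {θ : Fin n → ℝ} (h : θ ∈ E.Θ) : E.clipΘ θ = θ := by
  ext j
  simp [clipΘ, projIcc_of_mem (E.a_lt_b j).le (E.mem_Θ.1 h j)]

theorem continuous_clipΓ : Continuous E.clipΓ := continuous_subtype_val.comp continuous_projIcc

theorem continuous_clipΘ : Continuous E.clipΘ :=
  continuous_pi fun j => continuous_subtype_val.comp (continuous_projIcc.comp (continuous_apply j))

/-- The conditional density, extended continuously from `Γ × Θ` to the whole space by
retraction. -/
def densExt (γ : ℝ) (θ : Fin n → ℝ) : ℝ := E.f (E.clipΓ γ) (E.clipΘ θ)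

/-- The derivative of the conditional density in `γ`, extended like `densExt`. -/
def slopeExt (γ : ℝ) (θ : Fin n → ℝ) : ℝ :=
  fderivWithin ℝ (fun p : ℝ × (Fin n → ℝ) => E.f p.1 p.2) (Icc E.lo E.hi ×ˢ Icc E.a E.b)
    (E.clipΓ γ, E.clipΘ θ) (1, 0)

theorem clip_prod_mem (p : ℝ × (Fin n → ℝ)) :
    (E.clipΓ p.1, E.clipΘ p.2) ∈ Icc E.lo E.hi ×ˢ Icc E.a E.b :=
  ⟨E.clipΓ_mem _, E.clipΘ_mem _⟩

theorem continuous_clip_prod :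
    Continuous fun p : ℝ × (Fin n → ℝ) => (E.clipΓ p.1, E.clipΘ p.2) :=
  (E.continuous_clipΓ.comp continuous_fst).prodMk (E.continuous_clipΘ.comp continuous_snd)

theorem continuous_densExt : Continuous (Function.uncurry E.densExt) :=
  E.f_contDiff.continuousOn.comp_continuous E.continuous_clip_prod E.clip_prod_mem

theorem uniqueDiffOn_prod : UniqueDiffOn ℝ (Icc E.lo E.hi ×ˢ Icc E.a E.b) := by
  refine (uniqueDiffOn_Icc E.lo_lt_hi).prod ?_
  rw [← pi_univ_Icc]
  exact UniqueDiffOn.univ_pi fun j => uniqueDiffOn_Icc (E.a_lt_b j)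

theorem continuous_slopeExt : Continuous (Function.uncurry E.slopeExt) := by
  have h := E.f_contDiff.continuousOn_fderivWithin E.uniqueDiffOn_prod le_rfl
  exact (h.comp_continuous E.continuous_clip_prod E.clip_prod_mem).clm_apply continuous_const

theorem densExt_of_mem {γ : ℝ} (hγ : γ ∈ E.Γ) {θ : Fin n → ℝ} (hθ : θ ∈ E.Θ) :
    E.densExt γ θ = E.f γ θ := by
  rw [densExt, E.clipΓ_of_mem hγ, E.clipΘ_of_mem hθ]

theorem densExt_pos (γ : ℝ) {θ : Fin n → ℝ} (hθ : θ ∈ E.Θint) : 0 < E.densExt γ θ := by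
  rw [densExt, E.clipΘ_of_mem (E.Θint_subset_Θ hθ)]
  exact E.f_pos _ (E.clipΓ_mem γ) _ hθ

theorem densExt_nonneg (γ : ℝ) (θ : Fin n → ℝ) : 0 ≤ E.densExt γ θ := by
  have hcl : closure E.Θint = E.Θ := by
    have : E.Θint = univ.pi fun j => Ioo (E.a j) (E.b j) := by ext; simp [Θint]
    rw [this, closure_pi_set]
    simp_rw [closure_Ioo (E.a_lt_b _).ne]
    exact pi_univ_Icc _ _
  have hclosed : IsClosed {θ | 0 ≤ E.densExt γ θ} :=
    isClosed_le continuous_const (E.continuous_densExt.uncurry_left γ)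
  have h : E.Θ ⊆ {θ | 0 ≤ E.densExt γ θ} :=
    hcl ▸ closure_minimal (fun θ hθ => (E.densExt_pos γ hθ).le) hclosed
  have := h (E.clipΘ_mem θ)
  rwa [mem_ofPred_eq, densExt, E.clipΘ_of_mem (E.clipΘ_mem θ)] at this

theorem densExt_sub {s : ℝ} (hs : s ∈ E.Γ) (θ : Fin n → ℝ) :
    E.densExt s θ - E.densExt E.lo θ = ∫ r in E.lo..s, E.slopeExt r θ := by
  have hcθ : Continuous fun r => E.densExt r θ := E.continuous_densExt.uncurry_right θ
  refine (intervalIntegral.integral_eq_sub_of_hasDerivAt_of_le hs.1 hcθ.continuousOn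
    (fun r hr => ?_) ((E.continuous_slopeExt.uncurry_right θ).intervalIntegrable _ _)).symm
  have hr' : r ∈ Ioo E.lo E.hi := ⟨hr.1, hr.2.trans_le hs.2⟩
  have hd := (E.f_contDiff.differentiableOn one_ne_zero _
    (E.clip_prod_mem (r, θ))).hasFDerivWithinAt
  have hd' : HasFDerivWithinAt (fun p : ℝ × (Fin n → ℝ) => E.f p.1 p.2)
      (fderivWithin ℝ (fun p : ℝ × (Fin n → ℝ) => E.f p.1 p.2) (Icc E.lo E.hi ×ˢ Icc E.a E.b)
        (r, E.clipΘ θ))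
      (Icc E.lo E.hi ×ˢ Icc E.a E.b) (r, E.clipΘ θ) := by
    rwa [E.clipΓ_of_mem (Ioo_subset_Icc_self hr')] at hd
  have hcurve : HasDerivWithinAt (fun u : ℝ => (u, E.clipΘ θ)) ((1 : ℝ), (0 : Fin n → ℝ))
      (Icc E.lo E.hi) r := (hasDerivWithinAt_id _ _).prodMk (hasDerivWithinAt_const _ _ _)
  have hmaps : MapsTo (fun u : ℝ => (u, E.clipΘ θ)) (Icc E.lo E.hi)
      (Icc E.lo E.hi ×ˢ Icc E.a E.b) := fun u hu => ⟨hu, E.clipΘ_mem θ⟩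
  have h := hd'.comp_hasDerivWithinAt r hcurve hmaps
  have h' := h.hasDerivAt (Icc_mem_nhds hr'.1 hr'.2)
  have hval : E.slopeExt r θ = fderivWithin ℝ (fun p : ℝ × (Fin n → ℝ) => E.f p.1 p.2)
      (Icc E.lo E.hi ×ˢ Icc E.a E.b) (r, E.clipΘ θ) (1, 0) := by
    rw [slopeExt, E.clipΓ_of_mem (Ioo_subset_Icc_self hr')]
  rw [hval]
  refine (h'.congr_of_eventuallyEq ?_)
  filter_upwards [Icc_mem_nhds hr'.1 hr'.2] with u hu
  simp [densExt, E.clipΓ_of_mem hu]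

theorem measurableSet_Θ : MeasurableSet E.Θ := measurableSet_Icc

theorem dens_eq {γ : ℝ} (hγ : γ ∈ E.Γ) :
    E.dens γ = E.Θ.indicator fun θ => ENNReal.ofReal (E.densExt γ θ) := by
  refine indicator_congr fun θ hθ => ?_
  rw [E.densExt_of_mem hγ hθ]

theorem measurable_dens {γ : ℝ} (hγ : γ ∈ E.Γ) : Measurable (E.dens γ) := by
  rw [E.dens_eq hγ]
  exact ((E.continuous_densExt.uncurry_left γ).measurable.ennreal_ofReal).indicator
    E.measurableSet_Θ

theorem isProbabilityMeasure_law {γ : ℝ} (hγ : γ ∈ E.Γ) : IsProbabilityMeasure (E.law γ) := by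
  constructor
  have hi : IntegrableOn (E.densExt γ) E.Θ :=
    (E.continuous_densExt.uncurry_left γ).continuousOn.integrableOn_compact isCompact_Icc
  rw [law, withDensity_apply _ MeasurableSet.univ, setLIntegral_univ, E.dens_eq hγ,
    lintegral_indicator E.measurableSet_Θ, ← ofReal_integral_eq_lintegral_ofReal hi
      (.of_forall fun θ => E.densExt_nonneg γ θ),
    setIntegral_congr_fun E.measurableSet_Θ fun θ hθ => E.densExt_of_mem hγ hθ, Θ,
    E.f_integral γ hγ, ENNReal.ofReal_one]

/-- The integral of `h γ` over the slice of `Θ` on which the `j`th coordinate equals `y`. -/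
def slice (j : Fin n) (h : ℝ → (Fin n → ℝ) → ℝ) (γ y : ℝ) : ℝ :=
  ∫ w in Icc (fun i : Finset.univ.erase j => E.a i) (fun i => E.b i),
    h γ (Function.updateFinset (fun _ => y) (Finset.univ.erase j) w)

theorem continuous_updateFinset_slice (j : Fin n) :
    Continuous fun p : ℝ × (Finset.univ.erase j → ℝ) =>
      Function.updateFinset (π := fun _ : Fin n => ℝ) (fun _ => p.1) (Finset.univ.erase j) p.2 := by
  refine continuous_pi fun i => ?_
  by_cases hi : i ∈ Finset.univ.erase j
  · simp only [Function.updateFinset, hi, dite_true]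
    fun_prop
  · simp only [Function.updateFinset, hi, dite_false]
    fun_prop

theorem continuous_slice (j : Fin n) {h : ℝ → (Fin n → ℝ) → ℝ}
    (hh : Continuous (Function.uncurry h)) : Continuous (Function.uncurry (E.slice j h)) := by
  refine continuous_parametric_integral_of_continuous (X := ℝ × ℝ) (f := fun p w => h p.1
    (Function.updateFinset (fun _ => p.2) (Finset.univ.erase j) w)) ?_ isCompact_Icc
  exact hh.comp ((continuous_fst.comp continuous_fst).prodMk
    ((continuous_updateFinset_slice j).comp
      ((continuous_snd.comp continuous_fst).prodMk continuous_snd)))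

/-- The marginal density, extended continuously to the whole plane. -/
def margP (j : Fin n) : ℝ → ℝ → ℝ := E.slice j E.densExt

/-- The derivative in `γ` of the marginal density, extended continuously to the whole plane. -/
def margK (j : Fin n) : ℝ → ℝ → ℝ := E.slice j E.slopeExt

theorem continuous_margP (j : Fin n) : Continuous (Function.uncurry (E.margP j)) :=
  E.continuous_slice j E.continuous_densExt

theorem continuous_margK (j : Fin n) : Continuous (Function.uncurry (E.margK j)) :=
  E.continuous_slice j E.continuous_slopeExt

theorem margP_sub (j : Fin n) {s : ℝ} (hs : s ∈ E.Γ) (y : ℝ) :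
    E.margP j s y - E.margP j E.lo y = ∫ r in E.lo..s, E.margK j r y := by
  have hu : Continuous fun w => Function.updateFinset (π := fun _ : Fin n => ℝ) (fun _ => y)
      (Finset.univ.erase j) w :=
    (continuous_updateFinset_slice j).comp (continuous_const.prodMk continuous_id)
  have hi : ∀ r, IntegrableOn (fun w => E.densExt r (Function.updateFinset (fun _ => y)
      (Finset.univ.erase j) w)) (Icc (fun i : Finset.univ.erase j => E.a i) fun i => E.b i) :=
    fun r => ((E.continuous_densExt.uncurry_left r).comp hu).continuousOn.integrableOn_compact
      isCompact_Icc
  rw [margP, slice, slice, ← integral_sub (hi s) (hi E.lo)]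
  simp_rw [E.densExt_sub hs]
  refine integral_intervalIntegral_swap ?_ isCompact_Icc _ _
  exact E.continuous_slopeExt.comp (continuous_fst.prodMk (hu.comp continuous_snd))

theorem updateFinset_mem_Θ {j : Fin n} {y : ℝ} (hy : y ∈ Icc (E.a j) (E.b j))
    (w : Finset.univ.erase j → ℝ) :
    Function.updateFinset (π := fun _ : Fin n => ℝ) (fun _ => y) (Finset.univ.erase j) w ∈ E.Θ ↔
      w ∈ Icc (fun i : Finset.univ.erase j => E.a i) fun i => E.b i := by
  rw [mem_Θ, ← pi_univ_Icc]
  constructor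
  · intro h i _
    simpa [Function.updateFinset, (Finset.mem_erase.1 i.2).1] using h i
  · intro h i
    by_cases hi : i = j
    · subst hi; simpa [Function.updateFinset] using hy
    · simpa [Function.updateFinset, hi] using h ⟨i, by simp [hi]⟩ trivial

theorem lmarginal_dens {j : Fin n} {γ y : ℝ} (hγ : γ ∈ E.Γ) :
    lmarginal (fun _ : Fin n => (volume : Measure ℝ)) (Finset.univ.erase j) (E.dens γ)
      (fun _ => y) =
      (Icc (E.a j) (E.b j)).indicator (fun y => ENNReal.ofReal (E.margP j γ y)) y := by
  by_cases hy : y ∈ Icc (E.a j) (E.b j)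
  · have hu : Continuous fun w => Function.updateFinset (π := fun _ : Fin n => ℝ) (fun _ => y)
        (Finset.univ.erase j) w :=
      (continuous_updateFinset_slice j).comp (continuous_const.prodMk continuous_id)
    have hi : IntegrableOn (fun w => E.densExt γ (Function.updateFinset (fun _ => y)
        (Finset.univ.erase j) w)) (Icc (fun i : Finset.univ.erase j => E.a i) fun i => E.b i) :=
      ((E.continuous_densExt.uncurry_left γ).comp hu).continuousOn.integrableOn_compact
        isCompact_Icc
    rw [indicator_of_mem hy, margP, slice, ofReal_integral_eq_lintegral_ofReal hi
      (.of_forall fun θ => E.densExt_nonneg γ _), ← lintegral_indicator measurableSet_Icc]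
    refine lintegral_congr fun w => ?_
    rw [E.dens_eq hγ]
    by_cases hw : w ∈ Icc (fun i : Finset.univ.erase j => E.a i) fun i => E.b i
    · rw [indicator_of_mem hw, indicator_of_mem ((E.updateFinset_mem_Θ hy w).2 hw)]
    · rw [indicator_of_notMem hw, indicator_of_notMem (mt (E.updateFinset_mem_Θ hy w).1 hw)]
  · rw [indicator_of_notMem hy]
    refine (lintegral_congr fun w => indicator_of_notMem (fun h => hy ?_) _).trans lintegral_zero
    simpa [Function.updateFinset] using E.mem_Θ.1 h j

theorem margP_nonneg (j : Fin n) (γ y : ℝ) : 0 ≤ E.margP j γ y :=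
  integral_nonneg fun _ => E.densExt_nonneg _ _

theorem margP_pos {j : Fin n} (γ : ℝ) {y : ℝ} (hy : y ∈ Ioo (E.a j) (E.b j)) :
    0 < E.margP j γ y := by
  have hu : Continuous fun w => Function.updateFinset (π := fun _ : Fin n => ℝ) (fun _ => y)
      (Finset.univ.erase j) w :=
    (continuous_updateFinset_slice j).comp (continuous_const.prodMk continuous_id)
  refine (setIntegral_pos_iff_support_of_nonneg_ae
    (.of_forall fun _ => E.densExt_nonneg _ _)
    (((E.continuous_densExt.uncurry_left γ).comp hu).continuousOn.integrableOn_compact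
        isCompact_Icc)).2 ?_
  have hopen : IsOpen (univ.pi fun i : Finset.univ.erase j => Ioo (E.a i) (E.b i)) :=
    isOpen_set_pi finite_univ fun _ _ => isOpen_Ioo
  have hne : (univ.pi fun i : Finset.univ.erase j => Ioo (E.a i) (E.b i)).Nonempty :=
    univ_pi_nonempty_iff.2 fun i => nonempty_Ioo.2 (E.a_lt_b i)
  refine (hopen.measure_pos volume hne).trans_le (measure_mono fun w hw => ⟨?_, ?_⟩)
  · refine (E.densExt_pos γ fun i => ?_).ne'
    by_cases hi : i = j
    · subst hi; simpa [Function.updateFinset] using hy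
    · simpa [Function.updateFinset, hi] using hw ⟨i, by simp [hi]⟩ trivial
  · rw [← pi_univ_Icc]
    exact fun i _ => Ioo_subset_Icc_self (hw i trivial)

theorem margDens_eq {j : Fin n} {γ y : ℝ} (hγ : γ ∈ E.Γ) (hy : y ∈ Icc (E.a j) (E.b j)) :
    E.margDens j γ y = E.margP j γ y := by
  rw [margDens, E.lmarginal_dens hγ, indicator_of_mem hy,
    ENNReal.toReal_ofReal (E.margP_nonneg j γ y)]

/-- The `j`th coordinate of `θ` has the marginal density as its density. -/
theorem law_map_eval (j : Fin n) {γ : ℝ} (hγ : γ ∈ E.Γ) :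
    (E.law γ).map (fun θ => θ j) = (volume.restrict (Icc (E.a j) (E.b j))).withDensity
      fun y => ENNReal.ofReal (E.margP j γ y) := by
  ext A hA
  have hA' : MeasurableSet {θ : Fin n → ℝ | θ j ∈ A} := measurable_pi_apply j hA
  rw [Measure.map_apply (measurable_pi_apply j) hA, law,
    withDensity_apply _ (measurable_pi_apply j hA), withDensity_apply _ hA,
    Measure.restrict_restrict hA, ← lintegral_indicator (hA.inter measurableSet_Icc),
    ← lintegral_indicator (measurable_pi_apply j hA)]
  have hm : Measurable ({θ : Fin n → ℝ | θ j ∈ A}.indicator (E.dens γ)) :=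
    (E.measurable_dens hγ).indicator hA'
  rw [volume_pi]
  change ∫⁻ θ, ({θ : Fin n → ℝ | θ j ∈ A}.indicator (E.dens γ)) θ ∂_ = _
  rw [lintegral_eq_lmarginal_univ (fun _ => 0), lmarginal_erase _ hm (Finset.mem_univ j)]
  refine lintegral_congr fun y => ?_
  rw [lmarginal_congr (y := fun _ => y) _ _ (by simp)]
  by_cases hy : y ∈ A
  · have : (A ∩ Icc (E.a j) (E.b j)).indicator (fun y => ENNReal.ofReal (E.margP j γ y)) y =
        (Icc (E.a j) (E.b j)).indicator (fun y => ENNReal.ofReal (E.margP j γ y)) y := by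
      simp [indicator, hy]
    rw [this, ← E.lmarginal_dens hγ]
    refine lintegral_congr fun w => indicator_of_mem ?_ _
    simpa [Function.updateFinset] using hy
  · rw [indicator_of_notMem fun h => hy h.1]
    refine (lintegral_congr fun w => indicator_of_notMem ?_ _).trans lintegral_zero
    simpa [Function.updateFinset] using hy

theorem integral_law_eval {j : Fin n} {γ : ℝ} (hγ : γ ∈ E.Γ) (h : ℝ → ℝ)
    (hm : AEStronglyMeasurable h ((E.law γ).map (fun θ => θ j))) :
    ∫ θ, h (θ j) ∂(E.law γ) = ∫ y in Icc (E.a j) (E.b j), E.margP j γ y * h y := by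
  rw [← integral_map (φ := fun θ : Fin n → ℝ => θ j) (f := h)
    (measurable_pi_apply j).aemeasurable hm, E.law_map_eval j hγ,
    integral_withDensity_eq_integral_toReal_smul
      ((E.continuous_margP j).uncurry_left γ).measurable.ennreal_ofReal
      (.of_forall fun _ => ENNReal.ofReal_lt_top)]
  simp [ENNReal.toReal_ofReal (E.margP_nonneg _ _ _)]

theorem margCdf_eq {j : Fin n} {γ x : ℝ} (hγ : γ ∈ E.Γ) (hx : x ∈ Icc (E.a j) (E.b j)) :
    E.margCdf j γ x = ∫ y in (E.a j)..x, E.margP j γ y := by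
  have h : E.law γ {θ | θ j ≤ x} = (E.law γ).map (fun θ => θ j) (Iic x) :=
    (Measure.map_apply (measurable_pi_apply j) measurableSet_Iic).symm
  have hc : Continuous (E.margP j γ) := (E.continuous_margP j).uncurry_left γ
  have hset : Iic x ∩ Icc (E.a j) (E.b j) = Icc (E.a j) x := by
    ext y; exact ⟨fun h => ⟨h.2.1, h.1⟩, fun h => ⟨h.2, h.1, h.2.trans hx.2⟩⟩
  rw [margCdf, measureReal_def, h, E.law_map_eval j hγ, withDensity_apply _ measurableSet_Iic,
    Measure.restrict_restrict measurableSet_Iic, hset, ← ofReal_integral_eq_lintegral_ofReal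
      (hc.continuousOn.integrableOn_compact isCompact_Icc)
      (.of_forall fun y => E.margP_nonneg j γ y), ENNReal.toReal_ofReal
      (integral_nonneg fun y => E.margP_nonneg j γ y), integral_Icc_eq_integral_Ioc,
    intervalIntegral.integral_of_le hx.1]

theorem integral_margP (j : Fin n) {γ : ℝ} (hγ : γ ∈ E.Γ) :
    ∫ y in (E.a j)..(E.b j), E.margP j γ y = 1 := by
  have := E.isProbabilityMeasure_law hγ
  have h := E.integral_law_eval (j := j) hγ (fun _ => 1) aestronglyMeasurable_const
  simp only [integral_const, probReal_univ, smul_eq_mul, mul_one] at h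
  rw [intervalIntegral.integral_of_le (E.a_lt_b j).le, ← integral_Icc_eq_integral_Ioc, ← h]

/-- The derivative of the marginal distribution function in `γ`, extended continuously to the
whole plane. -/
def margH (j : Fin n) (γ x : ℝ) : ℝ := ∫ y in (E.a j)..x, E.margK j γ y

theorem continuous_margH (j : Fin n) : Continuous (Function.uncurry (E.margH j)) :=
  intervalIntegral.continuous_parametric_intervalIntegral_of_continuous
    (f := fun p : ℝ × ℝ => E.margK j p.1) (μ := volume)
    ((E.continuous_margK j).comp ((continuous_fst.comp continuous_fst).prodMk continuous_snd))
    continuous_snd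

theorem integral_margP_sub (j : Fin n) {s : ℝ} (hs : s ∈ E.Γ) (x : ℝ) :
    (∫ y in (E.a j)..x, E.margP j s y) - ∫ y in (E.a j)..x, E.margP j E.lo y =
      ∫ r in E.lo..s, E.margH j r x := by
  rw [← intervalIntegral.integral_sub
    (((E.continuous_margP j).uncurry_left s).intervalIntegrable _ _)
    (((E.continuous_margP j).uncurry_left E.lo).intervalIntegrable _ _)]
  simp_rw [E.margP_sub j hs, margH]
  refine intervalIntegral_intervalIntegral_swap (F := fun y r => E.margK j r y) ?_
  exact (((E.continuous_margK j).comp continuous_swap).continuousOn.integrableOn_compact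
    (isCompact_uIcc.prod isCompact_uIcc)).mono_set (prod_mono uIoc_subset_uIcc uIoc_subset_uIcc)

theorem hasDerivWithinAt_integral_margP (j : Fin n) {γ : ℝ} (hγ : γ ∈ E.Γ) (x : ℝ) :
    HasDerivWithinAt (fun s => ∫ y in (E.a j)..x, E.margP j s y) (E.margH j γ x) E.Γ γ := by
  have hc : Continuous fun r => E.margH j r x := (E.continuous_margH j).uncurry_right x
  have h := ((hc.integral_hasStrictDerivAt E.lo γ).hasDerivAt.hasDerivWithinAt
    (s := E.Γ)).const_add (∫ y in (E.a j)..x, E.margP j E.lo y)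
  refine h.congr (fun s hs => ?_) ?_
  · rw [← E.integral_margP_sub j hs x]; ring
  · rw [← E.integral_margP_sub j hγ x]; ring

theorem uniqueDiffWithinAt_Γ {γ : ℝ} (hγ : γ ∈ E.Γ) : UniqueDiffWithinAt ℝ E.Γ γ :=
  uniqueDiffOn_Icc E.lo_lt_hi γ hγ

theorem margCdfDeriv_eq {j : Fin n} {γ x : ℝ} (hγ : γ ∈ E.Γ) (hx : x ∈ Icc (E.a j) (E.b j)) :
    E.margCdfDeriv j γ x = E.margH j γ x :=
  ((E.hasDerivWithinAt_integral_margP j hγ x).congr (fun _ hs => E.margCdf_eq hs hx)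
    (E.margCdf_eq hγ hx)).derivWithin (E.uniqueDiffWithinAt_Γ hγ)

/-! ### Invariance of the percentiles -/

/-- The marginal distribution function, as the primitive of the extended marginal density. -/
def margF (j : Fin n) (γ x : ℝ) : ℝ := ∫ y in (E.a j)..x, E.margP j γ y

theorem strictMonoOn_margF (j : Fin n) (γ : ℝ) :
    StrictMonoOn (E.margF j γ) (Icc (E.a j) (E.b j)) := by
  intro u hu w hw huw
  have hii : ∀ c d, IntervalIntegrable (E.margP j γ) volume c d := fun c d =>
    ((E.continuous_margP j).uncurry_left γ).intervalIntegrable _ _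
  rw [margF, margF, ← sub_pos, intervalIntegral.integral_interval_sub_left (hii _ _) (hii _ _)]
  exact intervalIntegral.intervalIntegral_pos_of_pos_on (hii _ _)
    (fun y hy => E.margP_pos γ ⟨hu.1.trans_lt hy.1, hy.2.trans_le hw.2⟩) huw

theorem continuous_margF (j : Fin n) : Continuous (Function.uncurry (E.margF j)) :=
  intervalIntegral.continuous_parametric_intervalIntegral_of_continuous
    (f := fun p : ℝ × ℝ => E.margP j p.1) (μ := volume)
    ((E.continuous_margP j).comp ((continuous_fst.comp continuous_fst).prodMk continuous_snd))
    continuous_snd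

theorem margF_left (j : Fin n) (γ : ℝ) : E.margF j γ (E.a j) = 0 := intervalIntegral.integral_same

theorem margF_right (j : Fin n) {γ : ℝ} (hγ : γ ∈ E.Γ) : E.margF j γ (E.b j) = 1 :=
  E.integral_margP j hγ

theorem margF_mem_Ioo_iff {j : Fin n} {γ x : ℝ} (hγ : γ ∈ E.Γ) (hx : x ∈ Icc (E.a j) (E.b j)) :
    E.margF j γ x ∈ Ioo (0 : ℝ) 1 ↔ x ∈ Ioo (E.a j) (E.b j) := by
  have hab := (E.a_lt_b j).le
  rw [mem_Ioo, mem_Ioo, ← E.margF_left j γ, ← E.margF_right j hγ,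
    (E.strictMonoOn_margF j γ).lt_iff_lt (left_mem_Icc.2 hab) hx,
    (E.strictMonoOn_margF j γ).lt_iff_lt hx (right_mem_Icc.2 hab)]

theorem surjOn_margF (j : Fin n) {γ : ℝ} (hγ : γ ∈ E.Γ) :
    SurjOn (E.margF j γ) (Ioo (E.a j) (E.b j)) (Ioo 0 1) := by
  have h := intermediate_value_Ioo (E.a_lt_b j).le
    ((E.continuous_margF j).uncurry_left γ).continuousOn
  rwa [E.margF_left, E.margF_right j hγ] at h

/-- The increasing map that carries the `j`th marginal at `γ` to the one at `γ'`: a valuation is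
sent to the valuation with the same percentile. -/
def transport (j : Fin n) (γ γ' x : ℝ) : ℝ :=
  Function.invFunOn (E.margF j γ') (Ioo (E.a j) (E.b j)) (E.margF j γ x)

variable {E}

theorem exists_margF_eq {j : Fin n} {γ γ' x : ℝ} (hγ : γ ∈ E.Γ) (hγ' : γ' ∈ E.Γ)
    (hx : x ∈ Ioo (E.a j) (E.b j)) :
    ∃ y ∈ Ioo (E.a j) (E.b j), E.margF j γ' y = E.margF j γ x :=
  E.surjOn_margF j hγ' ((E.margF_mem_Ioo_iff hγ (Ioo_subset_Icc_self hx)).2 hx)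

theorem transport_mem {j : Fin n} {γ γ' x : ℝ} (hγ : γ ∈ E.Γ) (hγ' : γ' ∈ E.Γ)
    (hx : x ∈ Ioo (E.a j) (E.b j)) : E.transport j γ γ' x ∈ Ioo (E.a j) (E.b j) :=
  Function.invFunOn_mem (exists_margF_eq hγ hγ' hx)

theorem margF_transport {j : Fin n} {γ γ' x : ℝ} (hγ : γ ∈ E.Γ) (hγ' : γ' ∈ E.Γ)
    (hx : x ∈ Ioo (E.a j) (E.b j)) : E.margF j γ' (E.transport j γ γ' x) = E.margF j γ x :=
  Function.invFunOn_eq (exists_margF_eq hγ hγ' hx)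

theorem transport_le_iff {j : Fin n} {γ γ' x y : ℝ} (hγ : γ ∈ E.Γ) (hγ' : γ' ∈ E.Γ)
    (hx : x ∈ Ioo (E.a j) (E.b j)) (hy : y ∈ Ioo (E.a j) (E.b j)) :
    E.transport j γ γ' x ≤ E.transport j γ γ' y ↔ x ≤ y := by
  rw [← (E.strictMonoOn_margF j γ').le_iff_le (Ioo_subset_Icc_self (transport_mem hγ hγ' hx))
    (Ioo_subset_Icc_self (transport_mem hγ hγ' hy)), margF_transport hγ hγ' hx,
    margF_transport hγ hγ' hy, (E.strictMonoOn_margF j γ).le_iff_le (Ioo_subset_Icc_self hx)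
    (Ioo_subset_Icc_self hy)]

theorem bijOn_transport {j : Fin n} {γ γ' : ℝ} (hγ : γ ∈ E.Γ) (hγ' : γ' ∈ E.Γ) :
    BijOn (E.transport j γ γ') (Ioo (E.a j) (E.b j)) (Ioo (E.a j) (E.b j)) := by
  refine ⟨fun x hx => transport_mem hγ hγ' hx, fun x hx y hy hxy => ?_, fun y hy => ?_⟩
  · exact le_antisymm ((transport_le_iff hγ hγ' hx hy).1 hxy.le)
      ((transport_le_iff hγ hγ' hy hx).1 hxy.ge)
  · obtain ⟨x, hx, hxy⟩ := exists_margF_eq (γ' := γ) hγ' hγ hy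
    refine ⟨x, hx, (E.strictMonoOn_margF j γ').injOn
      (Ioo_subset_Icc_self (transport_mem hγ hγ' hx)) (Ioo_subset_Icc_self hy) ?_⟩
    rw [margF_transport hγ hγ' hx, hxy]

theorem hasDerivWithinAt_transport {j : Fin n} {γ γ' x : ℝ} (hγ : γ ∈ E.Γ) (hγ' : γ' ∈ E.Γ)
    (hx : x ∈ Ioo (E.a j) (E.b j)) :
    HasDerivWithinAt (E.transport j γ γ') (E.margP j γ x / E.margP j γ' (E.transport j γ γ' x))
      (Ioo (E.a j) (E.b j)) x := by
  have h := hasDerivWithinAt_quantile (S := Ioo (E.a j) (E.b j)) (γ := x) hx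
    (p := fun _ => E.margP j γ') (x := E.transport j γ γ') (ψ := E.margF j γ)
    (ψ' := E.margP j γ x) (H := 0) (a := E.a j) (b := E.b j)
    (((E.continuous_margP j).uncurry_left γ').comp continuous_snd)
    (fun _ _ y hy => E.margP_pos γ' hy) (fun s hs => transport_mem hγ hγ' hs)
    (fun s hs => margF_transport hγ hγ' hs)
    (((E.continuous_margP j).uncurry_left γ).integral_hasStrictDerivAt
      (E.a j) x).hasDerivAt.hasDerivWithinAt
    (hasDerivWithinAt_const _ _ _)
  rwa [sub_zero] at h

/-- Under invariant dependencies, the density at `γ` is the pullback of the density at `γ'` under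
the transport of the single coordinates. -/
theorem f_eq_transport (hinv : E.InvariantDependencies) {γ γ' : ℝ} (hγ : γ ∈ E.Γ)
    (hγ' : γ' ∈ E.Γ) {θ : Fin n → ℝ} (hθ : θ ∈ E.Θint) :
    E.f γ θ = (∏ j, E.margP j γ (θ j) / E.margP j γ' (E.transport j γ γ' (θ j))) *
      E.f γ' fun j => E.transport j γ γ' (θ j) := by
  obtain ⟨c, hc⟩ := hinv
  have hT : (fun j => E.transport j γ γ' (θ j)) ∈ E.Θint := fun j => transport_mem hγ hγ' (hθ j)
  have hperc : (fun j => E.margCdf j γ' (E.transport j γ γ' (θ j))) =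
      fun j => E.margCdf j γ (θ j) := by
    ext j
    rw [E.margCdf_eq hγ' (Ioo_subset_Icc_self (hT j)), E.margCdf_eq hγ (Ioo_subset_Icc_self (hθ j))]
    exact margF_transport hγ hγ' (hθ j)
  rw [hc γ hγ θ hθ, hc γ' hγ' _ hT, hperc, mul_left_comm, ← Finset.prod_mul_distrib]
  congr 1
  refine Finset.prod_congr rfl fun j _ => ?_
  rw [E.margDens_eq hγ (Ioo_subset_Icc_self (hθ j)), E.margDens_eq hγ' (Ioo_subset_Icc_self (hT j)),
    div_mul_cancel₀ _ (E.margP_pos γ' (hT j)).ne']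

theorem dens_of_notMem {γ : ℝ} {θ : Fin n → ℝ} {j : Fin n} (h : θ j ∉ Icc (E.a j) (E.b j)) :
    E.dens γ θ = 0 := indicator_of_notMem (fun hθ => h (E.mem_Θ.1 hθ j)) _

theorem lmarginal_dens_lt_top {γ : ℝ} (hγ : γ ∈ E.Γ) (s : Finset (Fin n)) (θ : Fin n → ℝ) :
    lmarginal (fun _ => (volume : Measure ℝ)) s (E.dens γ) θ < ⊤ := by
  obtain ⟨C, hC⟩ := (isCompact_Icc (a := E.a) (b := E.b)).bddAbove_image
    (E.continuous_densExt.uncurry_left γ).continuousOn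
  have hle : ∀ w : s → ℝ, E.dens γ (Function.updateFinset θ s w) ≤
      (Icc (fun i : s => E.a i) fun i => E.b i).indicator (fun _ => ENNReal.ofReal C) w := by
    intro w
    by_cases h : Function.updateFinset θ s w ∈ E.Θ
    · have hw : w ∈ Icc (fun i : s => E.a i) fun i => E.b i := by
        rw [← pi_univ_Icc]
        intro i _
        simpa [Function.updateFinset] using E.mem_Θ.1 h i
      rw [E.dens_eq hγ, indicator_of_mem h, indicator_of_mem hw]
      exact ENNReal.ofReal_le_ofReal (hC (mem_image_of_mem _ h))
    · rw [dens, indicator_of_notMem h]; exact zero_le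
  refine (lintegral_mono hle).trans_lt ?_
  rw [lintegral_indicator measurableSet_Icc, setLIntegral_const]
  exact ENNReal.mul_lt_top ENNReal.ofReal_lt_top isCompact_Icc.measure_lt_top

theorem measurable_indicator_dens {γ : ℝ} (hγ : γ ∈ E.Γ) (k : Fin n) {A : Set ℝ}
    (hA : MeasurableSet A) : Measurable ({y : Fin n → ℝ | y k ∈ A}.indicator (E.dens γ)) :=
  (E.measurable_dens hγ).indicator (measurable_pi_apply k hA)

theorem lmarginal_dens_pos {γ : ℝ} (hγ : γ ∈ E.Γ) {s : Finset (Fin n)} {k : Fin n} (hk : k ∈ s)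
    {θ : Fin n → ℝ} (hθ : ∀ i ∉ s, θ i ∈ Ioo (E.a i) (E.b i)) {x x' : ℝ}
    (hx : E.a k ≤ x) (hxx' : x < x') (hx' : x' ≤ E.b k) :
    0 < lmarginal (fun _ => (volume : Measure ℝ)) s
      ({y : Fin n → ℝ | y k ∈ Ioc x x'}.indicator (E.dens γ)) θ := by
  set U : Set (s → ℝ) := univ.pi fun i => Ioo (E.a i) (E.b i) ∩
    (if (i : Fin n) = k then Ioo x x' else univ) with hU
  have hUo : IsOpen U := isOpen_set_pi finite_univ fun i _ => isOpen_Ioo.inter (by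
    split_ifs
    exacts [isOpen_Ioo, isOpen_univ])
  have hUne : U.Nonempty := by
    refine univ_pi_nonempty_iff.2 fun i => ?_
    split_ifs with h
    · rw [h, inter_eq_self_of_subset_right (Ioo_subset_Ioo hx hx')]
      exact nonempty_Ioo.2 hxx'
    · rw [inter_univ]; exact nonempty_Ioo.2 (E.a_lt_b i)
  have hm : Measurable fun w : s → ℝ => {y : Fin n → ℝ | y k ∈ Ioc x x'}.indicator (E.dens γ)
      (Function.updateFinset θ s w) :=
    (measurable_indicator_dens hγ k measurableSet_Ioc).comp measurable_updateFinset
  refine (lintegral_pos_iff_support hm).2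
    ((hUo.measure_pos volume hUne).trans_le (measure_mono fun w hw => ?_))
  have hint : Function.updateFinset θ s w ∈ E.Θint := fun i => by
    by_cases hi : i ∈ s
    · simpa [Function.updateFinset, hi] using (hw ⟨i, hi⟩ trivial).1
    · simpa [Function.updateFinset, hi] using hθ i hi
  have hkm : Function.updateFinset θ s w k ∈ Ioc x x' := by
    have h := (hw ⟨k, hk⟩ trivial).2
    simp only [if_true] at h
    simpa [Function.updateFinset, hk] using Ioo_subset_Ioc_self h
  rw [Function.mem_support, indicator_of_mem (show _ ∈ {y : Fin n → ℝ | y k ∈ Ioc x x'} from hkm),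
    E.dens_eq hγ, indicator_of_mem (E.Θint_subset_Θ hint)]
  exact (ENNReal.ofReal_pos.2 (E.densExt_pos γ hint)).ne'

theorem condCdf_lt {γ : ℝ} (hγ : γ ∈ E.Γ) {k : Fin n} {θ : Fin n → ℝ}
    (hθ : ∀ i < k, θ i ∈ Ioo (E.a i) (E.b i)) {x x' : ℝ}
    (hx : E.a k ≤ x) (hxx' : x < x') (hx' : x' ≤ E.b k) :
    E.condCdf k γ θ x < E.condCdf k γ θ x' := by
  have hθ' : ∀ i ∉ Finset.Ici k, θ i ∈ Ioo (E.a i) (E.b i) := fun i hi => hθ i (by simpa using hi)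
  have hpos := lmarginal_dens_pos hγ (Finset.mem_Ici.2 le_rfl) hθ' hx hxx' hx'
  have hle : ∀ A : Set (Fin n → ℝ), lmarginal (fun _ => (volume : Measure ℝ)) (Finset.Ici k)
      (A.indicator (E.dens γ)) θ ≤
      lmarginal (fun _ => (volume : Measure ℝ)) (Finset.Ici k) (E.dens γ) θ :=
    fun A => lmarginal_mono (indicator_le_self _ _) θ
  have htop := lmarginal_dens_lt_top hγ (Finset.Ici k) θ
  have hsum : lmarginal (fun _ => (volume : Measure ℝ)) (Finset.Ici k)
      ({y : Fin n → ℝ | y k ≤ x'}.indicator (E.dens γ)) θ =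
      lmarginal (fun _ => (volume : Measure ℝ)) (Finset.Ici k)
        ({y : Fin n → ℝ | y k ≤ x}.indicator (E.dens γ)) θ +
      lmarginal (fun _ => (volume : Measure ℝ)) (Finset.Ici k)
        ({y : Fin n → ℝ | y k ∈ Ioc x x'}.indicator (E.dens γ)) θ := by
    refine Eq.trans (lintegral_congr fun w => ?_) (lintegral_add_left
      ((measurable_indicator_dens hγ k measurableSet_Iic).comp measurable_updateFinset) _)
    simp only [indicator, Function.comp_apply]
    by_cases h1 : Function.updateFinset θ (Finset.Ici k) w k ≤ x
    · simp [h1, h1.trans hxx'.le, h1.not_gt]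
    · simp [h1, not_le.1 h1]
  rw [condCdf, condCdf]
  refine div_lt_div_of_pos_right ?_
    (ENNReal.toReal_pos (hpos.trans_le (hle _)).ne' htop.ne)
  refine (ENNReal.toReal_lt_toReal ((hle _).trans_lt htop).ne ((hle _).trans_lt htop).ne).2 ?_
  rw [hsum]
  exact ENNReal.lt_add_right ((hle _).trans_lt htop).ne hpos.ne'

/-- Under invariant dependencies, the transport of the coordinates preserves the conditional
percentiles. -/
theorem condCdf_transport (hinv : E.InvariantDependencies) {γ γ' : ℝ} (hγ : γ ∈ E.Γ)
    (hγ' : γ' ∈ E.Γ) {k : Fin n} {θ : Fin n → ℝ} (hθ : θ ∈ E.Θint) :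
    E.condCdf k γ' (fun j => E.transport j γ γ' (θ j)) (E.transport k γ γ' (θ k)) =
      E.condCdf k γ θ (θ k) := by
  have hrpos : ∀ j, ∀ x ∈ Ioo (E.a j) (E.b j),
      0 < E.margP j γ x / E.margP j γ' (E.transport j γ γ' x) := fun j x hx =>
    div_pos (E.margP_pos γ hx) (E.margP_pos γ' (transport_mem hγ hγ' hx))
  have hdens : ∀ θ, (∀ j, θ j ∈ Ioo (E.a j) (E.b j)) → E.dens γ θ =
      (∏ j, ENNReal.ofReal (E.margP j γ (θ j) / E.margP j γ' (E.transport j γ γ' (θ j)))) *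
        E.dens γ' fun j => E.transport j γ γ' (θ j) := by
    intro θ hθ
    have hT : (fun j => E.transport j γ γ' (θ j)) ∈ E.Θint := fun j => transport_mem hγ hγ' (hθ j)
    rw [dens, dens, indicator_of_mem (E.Θint_subset_Θ hθ), indicator_of_mem (E.Θint_subset_Θ hT),
      f_eq_transport hinv hγ hγ' hθ, ENNReal.ofReal_mul
        (Finset.prod_nonneg fun j _ => (hrpos j _ (hθ j)).le),
      ENNReal.ofReal_prod_of_nonneg fun j _ => (hrpos j _ (hθ j)).le]
  have key : ∀ A A' : Set (Fin n → ℝ), MeasurableSet A → MeasurableSet A' →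
      (∀ θ ∈ E.Θint, θ ∈ A ↔ (fun j => E.transport j γ γ' (θ j)) ∈ A') →
      lmarginal (fun _ => (volume : Measure ℝ)) (Finset.Ici k) (A.indicator (E.dens γ)) θ =
      (∏ j ∈ (Finset.Ici k)ᶜ,
        ENNReal.ofReal (E.margP j γ (θ j) / E.margP j γ' (E.transport j γ γ' (θ j)))) *
        lmarginal (fun _ => (volume : Measure ℝ)) (Finset.Ici k) (A'.indicator (E.dens γ'))
          fun j => E.transport j γ γ' (θ j) := by
    intro A A' hA hA' hAA'
    have hzero : ∀ (B : Set (Fin n → ℝ)) (γ : ℝ) (θ : Fin n → ℝ) (j : Fin n),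
        θ j ∉ Icc (E.a j) (E.b j) → B.indicator (E.dens γ) θ = 0 := by
      intro B γ θ j h
      simp only [indicator, dens_of_notMem h, ite_self]
    refine lmarginal_eq_of_coordinatewise (a := E.a) (b := E.b)
      (T := fun j => E.transport j γ γ')
      (r := fun j x => E.margP j γ x / E.margP j γ' (E.transport j γ γ' x))
      ((E.measurable_dens hγ).indicator hA) ((E.measurable_dens hγ').indicator hA')
      (hzero A γ) (hzero A' γ') (fun j => bijOn_transport hγ hγ')
      (fun j x hx => hasDerivWithinAt_transport hγ hγ' hx) hrpos (fun ϑ hϑ => ?_) _ θ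
      fun j _ => hθ j
    by_cases h : ϑ ∈ A
    · rw [indicator_of_mem h, indicator_of_mem ((hAA' ϑ hϑ).1 h), hdens ϑ hϑ]
    · rw [indicator_of_notMem h, indicator_of_notMem (mt (hAA' ϑ hϑ).2 h), mul_zero]
  have h1 := key {y | y k ≤ θ k} {y | y k ≤ E.transport k γ γ' (θ k)}
    (measurable_pi_apply k measurableSet_Iic) (measurable_pi_apply k measurableSet_Iic)
    fun ϑ hϑ => (transport_le_iff hγ hγ' (hϑ k) (hθ k)).symm
  have h2 := key univ univ .univ .univ (by simp)
  simp only [indicator_univ] at h2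
  have hc : (∏ j ∈ (Finset.Ici k)ᶜ,
      ENNReal.ofReal (E.margP j γ (θ j) / E.margP j γ' (E.transport j γ γ' (θ j)))).toReal ≠ 0 := by
    rw [ENNReal.toReal_prod]
    refine Finset.prod_ne_zero_iff.2 fun j _ => ?_
    rw [ENNReal.toReal_ofReal (hrpos j _ (hθ j)).le]
    exact (hrpos j _ (hθ j)).ne'
  rw [condCdf, condCdf, h1, h2, ENNReal.toReal_mul, ENNReal.toReal_mul, mul_div_mul_left _ _ hc]

/-- The percentiles of the valuations are functions of the shock alone, whichever way the
valuations are orthogonalized. -/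
theorem percentile_eq (hinv : E.InvariantDependencies) {v : ℝ → (Fin n → ℝ) → (Fin n → ℝ)}
    (hv : E.IsOrthogonalization v) {γ γ' : ℝ} (hγ : γ ∈ E.Γ) (hγ' : γ' ∈ E.Γ) {z : Fin n → ℝ}
    (hz : z ∈ openCube n) (hvz : v γ z ∈ E.Θint) :
    v γ' z ∈ E.Θint ∧ ∀ j, E.margF j γ' (v γ' z j) = E.margF j γ (v γ z j) := by
  have hzc : z ∈ Icc (0 : Fin n → ℝ) 1 := ⟨fun j => (hz j).1.le, fun j => (hz j).2.le⟩
  have hmem : ∀ j, v γ' z j ∈ Icc (E.a j) (E.b j) := E.mem_Θ.1 (hv.mapsTo γ' hγ' z hzc)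
  rcases hv.form with h | h
  · have hT : ∀ j, v γ' z j = E.transport j γ γ' (v γ z j) := by
      intro k
      induction k using WellFoundedLT.induction with
      | ind k ih =>
        have hcongr : ∀ x, E.condCdf k γ' (fun j => E.transport j γ γ' (v γ z j)) x =
            E.condCdf k γ' (v γ' z) x := by
          intro x
          rw [condCdf, condCdf]
          congr 2 <;> refine lmarginal_congr _ _ fun i hi => (ih i (by simpa using hi)).symm
        have hθ : ∀ i < k, v γ' z i ∈ Ioo (E.a i) (E.b i) := fun i hi => by
          rw [ih i hi]; exact transport_mem hγ hγ' (hvz i)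
        have heq := condCdf_transport hinv hγ hγ' (k := k) hvz
        rw [hcongr, h γ hγ z hz k, ← h γ' hγ' z hz k] at heq
        have hTk := transport_mem hγ hγ' (hvz k)
        rcases lt_trichotomy (v γ' z k) (E.transport k γ γ' (v γ z k)) with hlt | he | hlt
        · exact absurd heq (condCdf_lt hγ' hθ (hmem k).1 hlt hTk.2.le).ne'
        · exact he
        · exact absurd heq (condCdf_lt hγ' hθ hTk.1.le hlt (hmem k).2).ne
    exact ⟨fun j => hT j ▸ transport_mem hγ hγ' (hvz j),
      fun j => hT j ▸ margF_transport hγ hγ' (hvz j)⟩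
  · obtain ⟨c, hc⟩ := hinv
    have heq : ∀ j, E.margF j γ' (v γ' z j) = E.margF j γ (v γ z j) := fun j => by
      have := h γ' hγ' γ hγ ⟨c, hc γ' hγ', hc γ hγ⟩ z hz j
      rwa [E.margCdf_eq hγ' (hmem j), E.margCdf_eq hγ (Ioo_subset_Icc_self (hvz j))] at this
    refine ⟨fun j => (E.margF_mem_Ioo_iff hγ' (hmem j)).1 ?_, heq⟩
    rw [heq j]
    exact (E.margF_mem_Ioo_iff hγ (Ioo_subset_Icc_self (hvz j))).2 (hvz j)

/-! ### The impulse response -/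

theorem margF_sub (j : Fin n) {s s' : ℝ} (hs : s ∈ E.Γ) (hs' : s' ∈ E.Γ) (x : ℝ) :
    E.margF j s' x - E.margF j s x = ∫ r in s..s', E.margH j r x := by
  have hc : Continuous fun r => E.margH j r x := (E.continuous_margH j).uncurry_right x
  rw [← intervalIntegral.integral_interval_sub_left (a := E.lo)
    (hc.intervalIntegrable _ _) (hc.intervalIntegrable _ _), ← E.integral_margP_sub j hs,
    ← E.integral_margP_sub j hs', margF, margF]
  ring

theorem Regular.margH_nonpos (hreg : E.Regular) {j : Fin n} {γ x : ℝ} (hγ : γ ∈ E.Γ)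
    (hx : x ∈ Icc (E.a j) (E.b j)) : E.margH j γ x ≤ 0 := by
  have hclosed : IsClosed {x | E.margH j γ x ≤ 0} :=
    isClosed_le ((E.continuous_margH j).uncurry_left γ) continuous_const
  have hsub : Ioo (E.a j) (E.b j) ⊆ {x | E.margH j γ x ≤ 0} := fun y hy => by
    rw [mem_ofPred_eq, ← E.margCdfDeriv_eq hγ (Ioo_subset_Icc_self hy)]
    exact hreg.margCdfDeriv_nonpos j γ hγ y hy
  have := closure_minimal hsub hclosed
  rw [closure_Ioo (E.a_lt_b j).ne] at this
  exact this hx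

variable (E) in
/-- The impulse response `v_γ = -F_γ / f` of the `j`th valuation, as a function of the valuation. -/
def impulse (j : Fin n) (γ x : ℝ) : ℝ := -(E.margH j γ x / E.margP j γ x)

theorem measurable_impulse (j : Fin n) (γ : ℝ) : Measurable (E.impulse j γ) :=
  (((E.continuous_margH j).uncurry_left γ).measurable.div
    ((E.continuous_margP j).uncurry_left γ).measurable).neg

theorem virtualValue_eq {j : Fin n} {γ x : ℝ} (hγ : γ ∈ E.Γ) (hx : x ∈ Icc (E.a j) (E.b j)) :
    E.virtualValue j γ x = x - E.impulse j γ x * ((1 - E.G γ) / E.g γ) := by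
  rw [virtualValue, E.margCdfDeriv_eq hγ hx, E.margDens_eq hγ hx, impulse]
  ring

variable {v : ℝ → (Fin n → ℝ) → (Fin n → ℝ)}

theorem hasDerivWithinAt_valuation (hinv : E.InvariantDependencies) (hv : E.IsOrthogonalization v)
    {γ : ℝ} (hγ : γ ∈ E.Γ) {z : Fin n → ℝ} (hz : z ∈ openCube n) (hvz : v γ z ∈ E.Θint)
    (j : Fin n) :
    HasDerivWithinAt (fun s => v s z j) (E.impulse j γ (v γ z j)) E.Γ γ := by
  have h := hasDerivWithinAt_quantile (S := E.Γ) (a := E.a j) (b := E.b j) hγ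
    (p := E.margP j) (x := fun s => v s z j) (ψ := fun _ => E.margF j γ (v γ z j))
    (ψ' := 0) (H := E.margH j γ (v γ z j)) (E.continuous_margP j)
    (fun s _ y hy => E.margP_pos s hy) (fun s hs => (percentile_eq hinv hv hγ hs hz hvz).1 j)
    (fun s hs => (percentile_eq hinv hv hγ hs hz hvz).2 j) (hasDerivWithinAt_const _ _ _)
    (E.hasDerivWithinAt_integral_margP j hγ _)
  rwa [zero_sub, neg_div] at h

theorem monotoneOn_valuation (hreg : E.Regular) (hinv : E.InvariantDependencies)
    (hv : E.IsOrthogonalization v) {z : Fin n → ℝ} (hz : z ∈ openCube n)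
    (hvz : v E.lo z ∈ E.Θint) (j : Fin n) : MonotoneOn (fun s => v s z j) E.Γ := by
  intro s hs s' hs' hss'
  obtain ⟨hm, he⟩ := percentile_eq hinv hv E.lo_mem hs hz hvz
  obtain ⟨hm', he'⟩ := percentile_eq hinv hv E.lo_mem hs' hz hvz
  rw [← (E.strictMonoOn_margF j s').le_iff_le (Ioo_subset_Icc_self (hm j))
    (Ioo_subset_Icc_self (hm' j)), he' j, ← he j, ← sub_nonpos, margF_sub j hs hs', ← neg_nonneg,
    ← intervalIntegral.integral_neg]
  exact intervalIntegral.integral_nonneg hss' fun r hr => neg_nonneg.2 <|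
    hreg.margH_nonpos ⟨hs.1.trans hr.1, hr.2.trans hs'.2⟩ (Ioo_subset_Icc_self (hm j))

/-! ### Almost every shock -/

instance (n : ℕ) : IsProbabilityMeasure (unif n) := by
  constructor
  simp [unif, Real.volume_Icc_pi]

theorem ae_law_mem_Θint {γ : ℝ} : ∀ᵐ θ ∂(E.law γ), θ ∈ E.Θint := by
  have hac : ∀ᵐ θ ∂(volume.restrict E.Θ), θ ∈ E.Θint := by
    have h : (univ.pi fun j => Ioo (E.a j) (E.b j)) =ᵐ[volume] E.Θ :=
      Measure.univ_pi_Ioo_ae_eq_Icc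
    filter_upwards [ae_restrict_mem E.measurableSet_Θ,
      ae_restrict_of_ae h.mem_iff] with θ h1 h2
    exact fun j => h2.2 h1 j trivial
  have hlaw : E.law γ = (volume.restrict E.Θ).withDensity fun θ => ENNReal.ofReal (E.f γ θ) :=
    withDensity_indicator E.measurableSet_Θ _
  rw [hlaw]
  exact (withDensity_absolutelyContinuous _ _).ae_le hac

theorem ae_mem_openCube : ∀ᵐ z ∂(unif n), z ∈ openCube n := by
  have h : (univ.pi fun _ : Fin n => Ioo (0 : ℝ) 1) =ᵐ[volume] Icc (0 : Fin n → ℝ) 1 :=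
    Measure.univ_pi_Ioo_ae_eq_Icc
  filter_upwards [ae_restrict_mem (μ := volume) (measurableSet_Icc (a := (0 : Fin n → ℝ)) (b := 1)),
    ae_restrict_of_ae h.mem_iff] with θ h1 h2
  exact fun j => h2.2 h1 j trivial

theorem IsOrthogonalization.measurable_apply (hv : E.IsOrthogonalization v) (γ : ℝ) :
    Measurable (v γ) := hv.measurable.of_uncurry_left

theorem ae_interior (hinv : E.InvariantDependencies) (hv : E.IsOrthogonalization v) :
    ∀ᵐ z ∂(unif n), z ∈ openCube n ∧ ∀ s ∈ E.Γ, v s z ∈ E.Θint := by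
  have h : ∀ᵐ z ∂(unif n), v E.lo z ∈ E.Θint := by
    refine ae_of_ae_map (hv.measurable_apply E.lo).aemeasurable (p := fun θ => θ ∈ E.Θint) ?_
    rw [hv.map_unif E.lo E.lo_mem]
    exact ae_law_mem_Θint
  filter_upwards [h, ae_mem_openCube] with z h1 h2
  exact ⟨h2, fun s hs => (percentile_eq hinv hv E.lo_mem hs h2 h1).1⟩

theorem map_valuation (hv : E.IsOrthogonalization v) {γ : ℝ} (hγ : γ ∈ E.Γ) (j : Fin n) :
    (unif n).map (fun z => v γ z j) = (volume.restrict (Icc (E.a j) (E.b j))).withDensity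
      fun y => ENNReal.ofReal (E.margP j γ y) := by
  rw [← E.law_map_eval j hγ, ← hv.map_unif γ hγ,
    Measure.map_map (measurable_pi_apply j) (hv.measurable_apply γ)]
  rfl

theorem measurable_valuation (hv : E.IsOrthogonalization v) (γ : ℝ) (j : Fin n) :
    Measurable fun z => v γ z j := (measurable_pi_apply j).comp (hv.measurable_apply γ)

theorem integrable_comp_valuation (hv : E.IsOrthogonalization v) {γ : ℝ} (hγ : γ ∈ E.Γ)
    {j : Fin n} {h : ℝ → ℝ}
    (hi : IntegrableOn (fun y => E.margP j γ y * h y) (Icc (E.a j) (E.b j))) :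
    Integrable (fun z => h (v γ z j)) (unif n) := by
  have hp : Measurable fun y => ENNReal.ofReal (E.margP j γ y) :=
    ((E.continuous_margP j).uncurry_left γ).measurable.ennreal_ofReal
  have h1 : Integrable h ((unif n).map (fun z => v γ z j)) := by
    rw [map_valuation hv hγ j, integrable_withDensity_iff_integrable_smul' hp
      (.of_forall fun _ => ENNReal.ofReal_lt_top)]
    simpa [ENNReal.toReal_ofReal (E.margP_nonneg _ _ _), IntegrableOn] using hi
  exact h1.comp_measurable (measurable_valuation hv γ j)

theorem integral_comp_valuation (hv : E.IsOrthogonalization v) {γ : ℝ} (hγ : γ ∈ E.Γ)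
    {j : Fin n} {h : ℝ → ℝ} (hm : Measurable h) :
    ∫ z, h (v γ z j) ∂(unif n) = ∫ y in Icc (E.a j) (E.b j), E.margP j γ y * h y := by
  have hp : Measurable fun y => ENNReal.ofReal (E.margP j γ y) :=
    ((E.continuous_margP j).uncurry_left γ).measurable.ennreal_ofReal
  rw [← integral_map (φ := fun z => v γ z j) (measurable_valuation hv γ j).aemeasurable
    hm.aestronglyMeasurable, map_valuation hv hγ j,
    integral_withDensity_eq_integral_toReal_smul hp (.of_forall fun _ => ENNReal.ofReal_lt_top)]
  simp [ENNReal.toReal_ofReal (E.margP_nonneg _ _ _)]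

theorem ae_restrict_mem_Ioo (j : Fin n) :
    ∀ᵐ y ∂(volume.restrict (Icc (E.a j) (E.b j))), y ∈ Ioo (E.a j) (E.b j) := by
  rw [← restrict_Ioo_eq_restrict_Icc]
  exact ae_restrict_mem measurableSet_Ioo

theorem margP_mul_impulse_ae (j : Fin n) (γ : ℝ) :
    (fun y => E.margP j γ y * E.impulse j γ y) =ᵐ[volume.restrict (Icc (E.a j) (E.b j))]
      fun y => -E.margH j γ y := by
  filter_upwards [ae_restrict_mem_Ioo j] with y hy
  have := (E.margP_pos γ hy).ne'
  rw [impulse]; field_simp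

theorem integrable_impulse (hv : E.IsOrthogonalization v) {γ : ℝ} (hγ : γ ∈ E.Γ) (j : Fin n) :
    Integrable (fun z => E.impulse j γ (v γ z j)) (unif n) :=
  integrable_comp_valuation hv hγ (h := E.impulse j γ)
    ((((E.continuous_margH j).uncurry_left γ).neg.continuousOn.integrableOn_compact
      isCompact_Icc).congr (margP_mul_impulse_ae j γ).symm)

theorem integrable_valuation (hv : E.IsOrthogonalization v) {γ : ℝ} (hγ : γ ∈ E.Γ) (j : Fin n) :
    Integrable (fun z => v γ z j) (unif n) :=
  integrable_comp_valuation hv hγ (h := fun x => x)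
    ((((E.continuous_margP j).uncurry_left γ).mul continuous_id).continuousOn.integrableOn_compact
      isCompact_Icc)

/-! ### Expected surplus above a price -/

variable (E) in
/-- The buyer's expected surplus `E[(θʲ - p)⁺ | γ] = ∫ₚᵇ (1 - Fʲ(y|γ)) dy` from good `j` at the
price `p`. -/
def callValue (j : Fin n) (γ p : ℝ) : ℝ := ∫ y in p..(E.b j), (1 - E.margF j γ y)

variable (E) in
/-- The derivative of `callValue` in `γ`. -/
def callSlope (j : Fin n) (γ p : ℝ) : ℝ := ∫ y in p..(E.b j), -E.margH j γ y

theorem integral_max_valuation (hv : E.IsOrthogonalization v) {γ : ℝ} (hγ : γ ∈ E.Γ) {j : Fin n}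
    {p : ℝ} (hp : p ∈ Icc (E.a j) (E.b j)) :
    ∫ z, max (v γ z j - p) 0 ∂(unif n) = E.callValue j γ p := by
  have hc : Continuous (E.margP j γ) := (E.continuous_margP j).uncurry_left γ
  have hF : ∀ y, HasDerivAt (fun y => E.margF j γ y) (E.margP j γ y) y := fun y =>
    (hc.integral_hasStrictDerivAt (E.a j) y).hasDerivAt
  have hFc : Continuous (E.margF j γ) := (E.continuous_margF j).uncurry_left γ
  have h0 := integral_comp_valuation hv hγ (j := j) (h := fun x => max (x - p) 0) (by fun_prop)
  have hi : ∀ c d, IntervalIntegrable (fun y => E.margP j γ y * max (y - p) 0) volume c d :=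
    fun c d => Continuous.intervalIntegrable (by fun_prop) c d
  have h1 : ∫ y in (E.a j)..p, E.margP j γ y * max (y - p) 0 = 0 := by
    refine (intervalIntegral.integral_congr (g := fun _ => 0) fun y hy => ?_).trans (by simp)
    rw [uIcc_of_le hp.1] at hy
    simp [hy.2]
  have h2 : ∫ y in p..(E.b j), E.margP j γ y * max (y - p) 0 =
      ∫ y in p..(E.b j), (y - p) * E.margP j γ y := by
    refine intervalIntegral.integral_congr fun y hy => ?_
    rw [uIcc_of_le hp.2] at hy
    simp only [max_eq_left (sub_nonneg.2 hy.1), mul_comm]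
  rw [h0, integral_Icc_eq_integral_Ioc, ← intervalIntegral.integral_of_le (E.a_lt_b j).le,
    ← intervalIntegral.integral_add_adjacent_intervals (hi _ p) (hi p _), h1, h2, zero_add,
    intervalIntegral.integral_mul_deriv_eq_deriv_mul (u := fun y => y - p) (u' := fun _ => 1)
      (fun y _ => (hasDerivAt_id y).sub_const p) (fun y _ => hF y)
      (intervalIntegrable_const) (hc.intervalIntegrable _ _), callValue,
    intervalIntegral.integral_sub intervalIntegrable_const (hFc.intervalIntegrable _ _),
    E.margF_right j hγ]
  simp

theorem continuous_callSlope (j : Fin n) : Continuous (Function.uncurry (E.callSlope j)) := by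
  have h : Function.uncurry (E.callSlope j) =
      fun q : ℝ × ℝ => -∫ y in (E.b j)..q.2, -E.margH j q.1 y := by
    ext q; rw [← intervalIntegral.integral_symm]; rfl
  rw [h]
  exact (intervalIntegral.continuous_parametric_intervalIntegral_of_continuous
    (f := fun p : ℝ × ℝ => fun y => -E.margH j p.1 y) (μ := volume)
    (((E.continuous_margH j).comp
      ((continuous_fst.comp continuous_fst).prodMk continuous_snd)).neg) continuous_snd).neg

theorem continuous_callValue (j : Fin n) : Continuous (Function.uncurry (E.callValue j)) := by
  have h : Function.uncurry (E.callValue j) =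
      fun q : ℝ × ℝ => -∫ y in (E.b j)..q.2, (1 - E.margF j q.1 y) := by
    ext q; rw [← intervalIntegral.integral_symm]; rfl
  rw [h]
  exact (intervalIntegral.continuous_parametric_intervalIntegral_of_continuous
    (f := fun p : ℝ × ℝ => fun y => 1 - E.margF j p.1 y) (μ := volume)
    (continuous_const.sub ((E.continuous_margF j).comp
      ((continuous_fst.comp continuous_fst).prodMk continuous_snd))) continuous_snd).neg

theorem callValue_sub (j : Fin n) {s s' : ℝ} (hs : s ∈ E.Γ) (hs' : s' ∈ E.Γ) (p : ℝ) :
    E.callValue j s' p - E.callValue j s p = ∫ r in s..s', E.callSlope j r p := by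
  have hc : ∀ s, Continuous fun y => 1 - E.margF j s y := fun s =>
    continuous_const.sub ((E.continuous_margF j).uncurry_left s)
  rw [callValue, callValue, ← intervalIntegral.integral_sub ((hc s').intervalIntegrable _ _)
    ((hc s).intervalIntegrable _ _)]
  have h : ∀ y, 1 - E.margF j s' y - (1 - E.margF j s y) = ∫ r in s..s', -E.margH j r y := by
    intro y
    rw [intervalIntegral.integral_neg, ← margF_sub j hs hs']; ring
  simp_rw [h]
  refine intervalIntegral_intervalIntegral_swap (F := fun y r => -E.margH j r y) ?_
  exact (((E.continuous_margH j).comp continuous_swap).neg.continuousOn.integrableOn_compact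
    (isCompact_uIcc.prod isCompact_uIcc)).mono_set (prod_mono uIoc_subset_uIcc uIoc_subset_uIcc)

theorem integral_impulse (hv : E.IsOrthogonalization v) {γ : ℝ} (hγ : γ ∈ E.Γ) (j : Fin n) :
    ∫ z, E.impulse j γ (v γ z j) ∂(unif n) = E.callSlope j γ (E.a j) := by
  rw [integral_comp_valuation hv hγ (measurable_impulse j γ),
    integral_congr_ae (margP_mul_impulse_ae j γ), integral_Icc_eq_integral_Ioc,
    ← intervalIntegral.integral_of_le (E.a_lt_b j).le, callSlope]

theorem integral_valuation_sub (hinv : E.InvariantDependencies) (hv : E.IsOrthogonalization v)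
    {s s' : ℝ} (hs : s ∈ E.Γ) (hs' : s' ∈ E.Γ) (j : Fin n) :
    (∫ z, v s' z j ∂(unif n)) - ∫ z, v s z j ∂(unif n) =
      ∫ r in s..s', E.callSlope j r (E.a j) := by
  have h : ∀ s ∈ E.Γ, ∫ z, v s z j ∂(unif n) = E.callValue j s (E.a j) + E.a j := by
    intro s hs
    have h1 : ∫ z, max (v s z j - E.a j) 0 ∂(unif n) = ∫ z, (v s z j - E.a j) ∂(unif n) := by
      refine integral_congr_ae ?_
      filter_upwards [ae_interior hinv hv] with z hz
      exact max_eq_left (sub_nonneg.2 (hz.2 s hs j).1.le)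
    rw [← integral_max_valuation hv hs (left_mem_Icc.2 (E.a_lt_b j).le), h1,
      integral_sub (integrable_valuation hv hs j) (integrable_const _)]
    simp
  rw [h s hs, h s' hs', ← callValue_sub j hs hs']
  ring

/-- Multiplied by a fixed allocation, the expected valuation is differentiable in the type, although
the impulse response need not be bounded: the difference quotients are nonnegative and their means
converge. -/
theorem hasDerivWithinAt_integral_valuation (hreg : E.Regular) (hinv : E.InvariantDependencies)
    (hv : E.IsOrthogonalization v) {γ : ℝ} (hγ : γ ∈ E.Γ) (j : Fin n) {q : (Fin n → ℝ) → ℝ}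
    (hq : AEStronglyMeasurable q (unif n)) (hq1 : ∀ᵐ z ∂(unif n), ‖q z‖ ≤ 1) :
    HasDerivWithinAt (fun s => ∫ z, q z * v s z j ∂(unif n))
      (∫ z, q z * E.impulse j γ (v γ z j) ∂(unif n)) E.Γ γ := by
  rw [hasDerivWithinAt_iff_tendsto_slope]
  have hΓ : ∀ᶠ s in 𝓝[E.Γ \ {γ}] γ, s ∈ E.Γ := by
    filter_upwards [self_mem_nhdsWithin] with s hs using hs.1
  have hslope : ∀ s ∈ E.Γ, Integrable (fun z => slope (fun s => v s z j) γ s) (unif n) :=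
    fun s hs => by
      simp only [slope_def_field]
      exact ((integrable_valuation hv hs j).sub (integrable_valuation hv hγ j)).div_const _
  have hmean : HasDerivWithinAt (fun s => ∫ z, v s z j ∂(unif n))
      (∫ z, E.impulse j γ (v γ z j) ∂(unif n)) E.Γ γ := by
    rw [integral_impulse hv hγ]
    have hc : Continuous fun r => E.callSlope j r (E.a j) :=
      (continuous_callSlope j).uncurry_right _
    have h := ((hc.integral_hasStrictDerivAt γ γ).hasDerivAt.hasDerivWithinAt
      (s := E.Γ)).const_add (∫ z, v γ z j ∂(unif n))
    refine h.congr (fun s hs => ?_) ?_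
    · rw [← integral_valuation_sub hinv hv hγ hs]; ring
    · simp
  have h := tendsto_integral_mul_of_nonneg (μ := unif n) (l := 𝓝[E.Γ \ {γ}] γ)
    (F := fun s z => slope (fun s => v s z j) γ s) (f := fun z => E.impulse j γ (v γ z j))
    (hΓ.mono hslope) (hΓ.mono fun s hs => by
      filter_upwards [ae_interior hinv hv] with z hz
      rw [slope_def_field]
      have hmono := monotoneOn_valuation hreg hinv hv hz.1 (hz.2 _ E.lo_mem) j
      rcases le_total s γ with hle | hle
      · exact div_nonneg_of_nonpos (sub_nonpos.2 (hmono hs hγ hle)) (sub_nonpos.2 hle)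
      · exact div_nonneg (sub_nonneg.2 (hmono hγ hs hle)) (sub_nonneg.2 hle))
    (integrable_impulse hv hγ j) (by
      filter_upwards [ae_interior hinv hv] with z hz
      exact hasDerivWithinAt_iff_tendsto_slope.1
        (hasDerivWithinAt_valuation hinv hv hγ hz.1 (hz.2 _ hγ) j)) (by
      refine (hasDerivWithinAt_iff_tendsto_slope.1 hmean).congr' (hΓ.mono fun s hs => ?_)
      simp only [slope_def_field]
      rw [integral_div, integral_sub (integrable_valuation hv hs j) (integrable_valuation hv hγ j)])
    hq hq1
  refine h.congr' (hΓ.mono fun s hs => ?_)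
  simp only [slope_def_field]
  rw [← integral_sub ((integrable_valuation hv hs j).bdd_mul hq hq1)
    ((integrable_valuation hv hγ j).bdd_mul hq hq1), ← integral_div]
  refine integral_congr_ae (.of_forall fun z => ?_)
  ring

theorem exists_lipschitz_integral_valuation (hreg : E.Regular) (hinv : E.InvariantDependencies)
    (hv : E.IsOrthogonalization v) (j : Fin n) :
    ∃ K : ℝ, ∀ q : (Fin n → ℝ) → ℝ, AEStronglyMeasurable q (unif n) →
      (∀ᵐ z ∂(unif n), ‖q z‖ ≤ 1) → ∀ s ∈ E.Γ, ∀ s' ∈ E.Γ,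
      |(∫ z, q z * v s z j ∂(unif n)) - ∫ z, q z * v s' z j ∂(unif n)| ≤ K * |s - s'| := by
  have hc : Continuous fun r => E.callSlope j r (E.a j) :=
    (continuous_callSlope j).uncurry_right _
  obtain ⟨K, hK⟩ := isCompact_Icc.exists_bound_of_continuousOn
    (s := Icc E.lo E.hi) hc.continuousOn
  refine ⟨K, fun q hq hq1 => ?_⟩
  have key : ∀ s ∈ E.Γ, ∀ s' ∈ E.Γ, s ≤ s' →
      |(∫ z, q z * v s' z j ∂(unif n)) - ∫ z, q z * v s z j ∂(unif n)| ≤ K * |s' - s| := by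
    intro s hs s' hs' hss'
    have hi := (integrable_valuation hv hs j)
    have hi' := (integrable_valuation hv hs' j)
    have hbound : ‖∫ r in s..s', E.callSlope j r (E.a j)‖ ≤ K * |s' - s| := by
      refine intervalIntegral.norm_integral_le_of_norm_le_const fun r hr => hK r ?_
      rw [uIoc_of_le hss'] at hr
      exact ⟨hs.1.trans hr.1.le, hr.2.trans hs'.2⟩
    refine le_trans ?_ ((le_abs_self _).trans hbound)
    rw [← integral_valuation_sub hinv hv hs hs', ← integral_sub hi' hi,
      ← integral_sub (hi'.bdd_mul hq hq1) (hi.bdd_mul hq hq1), ← Real.norm_eq_abs]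
    refine (norm_integral_le_integral_norm _).trans (integral_mono_ae
      ((hi'.bdd_mul hq hq1).sub (hi.bdd_mul hq hq1)).norm (hi'.sub hi) ?_)
    filter_upwards [hq1, ae_interior hinv hv] with z hz hz'
    have hmono := monotoneOn_valuation hreg hinv hv hz'.1 (hz'.2 _ E.lo_mem) j hs hs' hss'
    rw [← mul_sub, norm_mul, Real.norm_of_nonneg (sub_nonneg.2 hmono)]
    exact mul_le_of_le_one_left (sub_nonneg.2 hmono) hz
  intro s hs s' hs'
  rcases le_total s s' with h | h
  · rw [abs_sub_comm, abs_sub_comm s]; exact key s hs s' hs' h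
  · exact key s' hs' s hs h

/-! ### The prior -/

theorem measurableSet_Γ : MeasurableSet E.Γ := measurableSet_Icc

theorem integrableOn_g : IntegrableOn E.g E.Γ := by
  by_contra h
  exact zero_ne_one ((integral_undef h).symm.trans E.g_integral)

theorem aemeasurable_ofReal_g :
    AEMeasurable (fun γ => ENNReal.ofReal (E.g γ)) (volume.restrict E.Γ) :=
  integrableOn_g.aemeasurable.ennreal_ofReal

instance isProbabilityMeasure_prior : IsProbabilityMeasure E.prior := by
  constructor
  rw [prior, withDensity_apply _ MeasurableSet.univ, setLIntegral_univ,
    ← ofReal_integral_eq_lintegral_ofReal integrableOn_g]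
  · rw [Γ, E.g_integral, ENNReal.ofReal_one]
  · filter_upwards [ae_restrict_mem measurableSet_Γ] with γ hγ using (E.g_pos γ hγ).le

theorem ae_prior_iff {p : ℝ → Prop} :
    (∀ᵐ γ ∂E.prior, p γ) ↔ ∀ᵐ γ ∂(volume.restrict E.Γ), p γ := by
  rw [prior, ae_withDensity_iff' aemeasurable_ofReal_g]
  refine ⟨fun h => ?_, fun h => h.mono fun _ hp _ => hp⟩
  filter_upwards [h, ae_restrict_mem measurableSet_Γ] with γ hp hγ
  exact hp (ENNReal.ofReal_pos.2 (E.g_pos γ hγ)).ne'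

theorem ae_prior_mem : ∀ᵐ γ ∂E.prior, γ ∈ E.Γ := ae_prior_iff.2 (ae_restrict_mem measurableSet_Γ)

theorem integral_prior (h : ℝ → ℝ) : ∫ γ, h γ ∂E.prior = ∫ γ in E.Γ, E.g γ * h γ := by
  rw [prior, integral_withDensity_eq_integral_toReal_smul₀ aemeasurable_ofReal_g
    (.of_forall fun _ => ENNReal.ofReal_lt_top)]
  refine setIntegral_congr_fun measurableSet_Γ fun γ hγ => ?_
  simp only [smul_eq_mul, ENNReal.toReal_ofReal (E.g_pos γ hγ).le]

theorem integrable_prior_iff {h : ℝ → ℝ} :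
    Integrable h E.prior ↔ IntegrableOn (fun γ => E.g γ * h γ) E.Γ := by
  rw [prior, integrable_withDensity_iff_integrable_smul₀' aemeasurable_ofReal_g
    (.of_forall fun _ => ENNReal.ofReal_lt_top)]
  refine integrable_congr ?_
  filter_upwards [ae_restrict_mem measurableSet_Γ] with γ hγ
  simp only [smul_eq_mul, ENNReal.toReal_ofReal (E.g_pos γ hγ).le]

theorem real_prior_Ioi (s : ℝ) : E.prior.real (Ioi s) = 1 - E.G s := by
  rw [G, ← compl_Iic, probReal_compl_eq_one_sub measurableSet_Iic]

theorem measurable_G : Measurable E.G :=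
  Monotone.measurable fun _ _ h => measureReal_mono (Iic_subset_Iic.2 h)

theorem one_sub_G_mem (s : ℝ) : 1 - E.G s ∈ Icc (0 : ℝ) 1 := by
  rw [← real_prior_Ioi]
  exact ⟨measureReal_nonneg, measureReal_le_one⟩

theorem integrableOn_one_sub_G_mul {m : ℝ → ℝ} (hm : IntegrableOn m E.Γ) :
    IntegrableOn (fun s => (1 - E.G s) * m s) E.Γ := by
  refine hm.bdd_mul (c := 1) (measurable_const.sub measurable_G).aestronglyMeasurable
    (.of_forall fun s => ?_)
  rw [Real.norm_of_nonneg (one_sub_G_mem s).1]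
  exact (one_sub_G_mem s).2

/-- Rents that accumulate at the rate `m` cost, in expectation, `m` weighted with the inverse hazard
rate. -/
theorem integral_prior_primitive {m : ℝ → ℝ} (hm : IntegrableOn m E.Γ) :
    Integrable (fun γ => ∫ s in E.lo..γ, m s) E.prior ∧
      ∫ γ, (∫ s in E.lo..γ, m s) ∂E.prior = ∫ s in E.Γ, (1 - E.G s) * m s := by
  have hset : MeasurableSet {p : ℝ × ℝ | p.2 < p.1} :=
    measurableSet_lt measurable_snd measurable_fst
  have hi : Integrable ({p : ℝ × ℝ | p.2 < p.1}.indicator fun p => m p.2)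
      (E.prior.prod (volume.restrict E.Γ)) := (hm.comp_snd E.prior).indicator hset
  have heq : ∀ γ ∈ E.Γ, ∫ s in E.lo..γ, m s =
      ∫ s in E.Γ, {p : ℝ × ℝ | p.2 < p.1}.indicator (fun p => m p.2) (γ, s) := by
    intro γ hγ
    have h1 : ∀ s, {p : ℝ × ℝ | p.2 < p.1}.indicator (fun p => m p.2) (γ, s) =
        (Iio γ).indicator m s := fun s => by simp [indicator]
    have h2 : E.Γ ∩ Iio γ = Ico E.lo γ := by
      ext s; exact ⟨fun h => ⟨h.1.1, h.2⟩, fun h => ⟨⟨h.1, h.2.le.trans hγ.2⟩, h.2⟩⟩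
    simp_rw [h1]
    rw [setIntegral_indicator measurableSet_Iio, h2, integral_Ico_eq_integral_Ioo,
      ← integral_Ioc_eq_integral_Ioo, intervalIntegral.integral_of_le hγ.1]
  refine ⟨hi.integral_prod_left.congr ?_, ?_⟩
  · filter_upwards [ae_prior_mem] with γ hγ using (heq γ hγ).symm
  · rw [integral_congr_ae (ae_prior_mem.mono heq),
      integral_integral_swap (f := fun γ s => {p : ℝ × ℝ | p.2 < p.1}.indicator
        (fun p => m p.2) (γ, s)) hi]
    refine integral_congr_ae (.of_forall fun s => ?_)
    have h1 : ∀ γ, {p : ℝ × ℝ | p.2 < p.1}.indicator (fun p => m p.2) (γ, s) =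
        (Ioi s).indicator (fun _ => m s) γ := fun γ => by simp [indicator]
    simp_rw [h1]
    rw [integral_indicator_const _ measurableSet_Ioi, real_prior_Ioi, smul_eq_mul]

/-! ### Profit in the relaxed problem -/

/-- An allocation rule of the relaxed problem: measurable and with values in the unit cube. -/
structure IsRule (E : Env n) (q : ℝ → (Fin n → ℝ) → (Fin n → ℝ)) : Prop where
  measurable : Measurable (Function.uncurry q)
  mem : ∀ γ ∈ E.Γ, ∀ z ∈ Icc (0 : Fin n → ℝ) 1, ∀ j, q γ z j ∈ Icc (0 : ℝ) 1

theorem RelaxedFeasible.isRule {N : RelaxedMechanism n} (hN : E.RelaxedFeasible v N) :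
    E.IsRule N.q := ⟨hN.measurable_q, hN.q_mem⟩

theorem ae_mem_cube : ∀ᵐ z ∂(unif n), z ∈ Icc (0 : Fin n → ℝ) 1 := ae_restrict_mem measurableSet_Icc

theorem IsRule.measurable_apply {q : ℝ → (Fin n → ℝ) → (Fin n → ℝ)} (hq : E.IsRule q) (γ : ℝ)
    (j : Fin n) : Measurable fun z => q γ z j :=
  (measurable_pi_apply j).comp hq.measurable.of_uncurry_left

theorem IsRule.norm_le {q : ℝ → (Fin n → ℝ) → (Fin n → ℝ)} (hq : E.IsRule q) {γ : ℝ} (hγ : γ ∈ E.Γ)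
    (j : Fin n) : ∀ᵐ z ∂(unif n), ‖q γ z j‖ ≤ 1 := by
  filter_upwards [ae_mem_cube] with z hz
  rw [Real.norm_of_nonneg (hq.mem γ hγ z hz j).1]
  exact (hq.mem γ hγ z hz j).2

theorem IsRule.integrable_mul {q : ℝ → (Fin n → ℝ) → (Fin n → ℝ)} (hq : E.IsRule q) {γ : ℝ}
    (hγ : γ ∈ E.Γ) (j : Fin n) {h : (Fin n → ℝ) → ℝ} (hh : Integrable h (unif n)) :
    Integrable (fun z => q γ z j * h z) (unif n) :=
  hh.bdd_mul (hq.measurable_apply γ j).aestronglyMeasurable (hq.norm_le hγ j)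

theorem IsRule.integrable_dotProduct {q : ℝ → (Fin n → ℝ) → (Fin n → ℝ)} (hq : E.IsRule q)
    (hv : E.IsOrthogonalization v) {γ γ' : ℝ} (hγ : γ ∈ E.Γ) (hγ' : γ' ∈ E.Γ) :
    Integrable (fun z => q γ' z ⬝ᵥ v γ z) (unif n) :=
  integrable_finsetSum _ fun j _ => hq.integrable_mul hγ' j (integrable_valuation hv hγ j)

variable (E v) in
/-- The rate `E_z[q̂ · v_γ]` at which the buyer's rent grows with his type. -/
def rentSlope (q : ℝ → (Fin n → ℝ) → (Fin n → ℝ)) (γ : ℝ) : ℝ :=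
  ∫ z, ∑ j, q γ z j * E.impulse j γ (v γ z j) ∂(unif n)

variable (v) in
/-- The gross surplus `E_z[q̂ · v]` of type `γ`. -/
def grossSurplus (q : ℝ → (Fin n → ℝ) → (Fin n → ℝ)) (γ : ℝ) : ℝ :=
  ∫ z, q γ z ⬝ᵥ v γ z ∂(unif n)

variable (E v) in
/-- The expected virtual surplus of type `γ`. -/
def interimSurplus (q : ℝ → (Fin n → ℝ) → (Fin n → ℝ)) (γ : ℝ) : ℝ :=
  ∫ z, ∑ j, q γ z j * E.virtualValue j γ (v γ z j) ∂(unif n)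

theorem integrable_virtualValue (hv : E.IsOrthogonalization v) {γ : ℝ} (hγ : γ ∈ E.Γ) (j : Fin n) :
    Integrable (fun z => E.virtualValue j γ (v γ z j)) (unif n) := by
  refine ((integrable_valuation hv hγ j).sub ((integrable_impulse hv hγ j).mul_const
    ((1 - E.G γ) / E.g γ))).congr ?_
  filter_upwards [ae_mem_cube] with z hz
  rw [virtualValue_eq hγ (E.mem_Θ.1 (hv.mapsTo γ hγ z hz) j)]
  rfl

theorem interimSurplus_eq (hv : E.IsOrthogonalization v) {q : ℝ → (Fin n → ℝ) → (Fin n → ℝ)}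
    (hq : E.IsRule q) {γ : ℝ} (hγ : γ ∈ E.Γ) :
    E.interimSurplus v q γ =
      grossSurplus v q γ - E.rentSlope v q γ * ((1 - E.G γ) / E.g γ) := by
  rw [interimSurplus, grossSurplus, rentSlope, ← integral_mul_const, ← integral_sub
    (hq.integrable_dotProduct hv hγ hγ) ((integrable_finsetSum _ fun j _ =>
      hq.integrable_mul hγ j (integrable_impulse hv hγ j)).mul_const _)]
  refine integral_congr_ae ?_
  filter_upwards [ae_mem_cube] with z hz
  simp only [dotProduct, Finset.sum_mul, ← Finset.sum_sub_distrib]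
  refine Finset.sum_congr rfl fun j _ => ?_
  rw [virtualValue_eq hγ (E.mem_Θ.1 (hv.mapsTo γ hγ z hz) j)]
  ring

theorem relaxedObjective_eq (hinv : E.InvariantDependencies) (hv : E.IsOrthogonalization v)
    (q : ℝ → (Fin n → ℝ) → (Fin n → ℝ)) :
    E.relaxedObjective v q = ∫ γ, E.interimSurplus v q γ ∂E.prior := by
  refine integral_congr_ae ?_
  filter_upwards [ae_prior_mem] with γ hγ
  refine integral_congr_ae ?_
  filter_upwards [ae_interior hinv hv] with z hz
  refine Finset.sum_congr rfl fun j _ => ?_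
  rw [(hasDerivWithinAt_valuation hinv hv hγ hz.1 (hz.2 γ hγ) j).derivWithin
    (E.uniqueDiffWithinAt_Γ hγ), virtualValue_eq hγ (Ioo_subset_Icc_self (hz.2 γ hγ j))]

theorem integrable_grossSurplus (hv : E.IsOrthogonalization v)
    {q : ℝ → (Fin n → ℝ) → (Fin n → ℝ)} (hq : E.IsRule q) :
    Integrable (grossSurplus v q) E.prior := by
  have hm : Measurable (Function.uncurry fun γ z => q γ z ⬝ᵥ v γ z) := by
    change Measurable fun p : ℝ × (Fin n → ℝ) =>
      ∑ j, Function.uncurry q p j * Function.uncurry v p j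
    exact Finset.measurable_fun_sum _ fun j _ =>
      ((measurable_pi_apply j).comp hq.measurable).mul ((measurable_pi_apply j).comp hv.measurable)
  have hsm : StronglyMeasurable (grossSurplus v q) := hm.stronglyMeasurable.integral_prod_right
  refine Integrable.of_bound (C := ∑ j, max |E.a j| |E.b j|) hsm.aestronglyMeasurable ?_
  filter_upwards [ae_prior_mem] with γ hγ
  refine (norm_integral_le_of_norm_le_const (C := ∑ j, max |E.a j| |E.b j|) ?_).trans (by simp)
  filter_upwards [ae_mem_cube] with z hz
  refine (norm_sum_le _ _).trans (Finset.sum_le_sum fun j _ => ?_)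
  have hvj := E.mem_Θ.1 (hv.mapsTo γ hγ z hz) j
  have hqj := hq.mem γ hγ z hz j
  rw [norm_mul, Real.norm_of_nonneg hqj.1]
  exact (mul_le_of_le_one_left (norm_nonneg _) hqj.2).trans (abs_le_max_abs_abs hvj.1 hvj.2)

variable (v) in
/-- The buyer's expected payoff in the relaxed problem. -/
def relaxedUtility (N : RelaxedMechanism n) (γ : ℝ) : ℝ :=
  (∫ z, N.q γ z ⬝ᵥ v γ z ∂(unif n)) - N.t γ

theorem RelaxedFeasible.relaxedUtility_eq {N : RelaxedMechanism n} (hN : E.RelaxedFeasible v N)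
    (hreg : E.Regular) (hinv : E.InvariantDependencies) (hv : E.IsOrthogonalization v) :
    IntegrableOn (E.rentSlope v N.q) E.Γ ∧ ∀ γ ∈ E.Γ, relaxedUtility v N γ =
      relaxedUtility v N E.lo + ∫ s in E.lo..γ, E.rentSlope v N.q s := by
  have hq := hN.isRule
  choose K hK using fun j => exists_lipschitz_integral_valuation hreg hinv hv j
  have hL : ∀ γ' ∈ E.Γ, ∀ γ ∈ E.Γ, ∫ z, N.q γ' z ⬝ᵥ v γ z ∂(unif n) =
      ∑ j, ∫ z, N.q γ' z j * v γ z j ∂(unif n) := fun γ' hγ' γ hγ =>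
    integral_finsetSum _ fun j _ => hq.integrable_mul hγ' j (integrable_valuation hv hγ j)
  refine envelope_formula (K := ∑ j, K j) E.lo_lt_hi
    (L := fun γ' γ => ∫ z, N.q γ' z ⬝ᵥ v γ z ∂(unif n)) (fun γ hγ γ' hγ' => ?_)
    (fun γ hγ s hs s' hs' => ?_) fun γ hγ => ?_
  · have := hN.ic γ hγ γ' hγ'
    simp only [relaxedUtility]
    linarith
  · rw [hL γ hγ s hs, hL γ hγ s' hs', ← Finset.sum_sub_distrib, Finset.sum_mul]
    exact (Finset.abs_sum_le_sum_abs _ _).trans (Finset.sum_le_sum fun j _ =>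
      hK j _ (hq.measurable_apply γ j).aestronglyMeasurable (hq.norm_le hγ j) s hs s' hs')
  · have h := HasDerivWithinAt.fun_sum (u := Finset.univ) fun j _ =>
      hasDerivWithinAt_integral_valuation hreg hinv hv hγ j
        (hq.measurable_apply γ j).aestronglyMeasurable (hq.norm_le hγ j)
    rw [← integral_finsetSum _ fun j _ => hq.integrable_mul hγ j (integrable_impulse hv hγ j)] at h
    exact h.congr (fun s hs => hL γ hγ s hs) (hL γ hγ γ hγ)

theorem g_mul_div_g {γ : ℝ} (hγ : γ ∈ E.Γ) (x : ℝ) :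
    E.g γ * (x * ((1 - E.G γ) / E.g γ)) = (1 - E.G γ) * x := by
  have := (E.g_pos γ hγ).ne'
  field_simp

theorem RelaxedFeasible.integrable_rent {N : RelaxedMechanism n} (hN : E.RelaxedFeasible v N)
    (hreg : E.Regular) (hinv : E.InvariantDependencies) (hv : E.IsOrthogonalization v) :
    Integrable (fun γ => E.rentSlope v N.q γ * ((1 - E.G γ) / E.g γ)) E.prior :=
  integrable_prior_iff.2 ((integrableOn_congr_fun (fun _ hγ => g_mul_div_g hγ _)
    measurableSet_Γ).2 (integrableOn_one_sub_G_mul (hN.relaxedUtility_eq hreg hinv hv).1))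

theorem RelaxedFeasible.integrable_interimSurplus {N : RelaxedMechanism n}
    (hN : E.RelaxedFeasible v N) (hreg : E.Regular) (hinv : E.InvariantDependencies)
    (hv : E.IsOrthogonalization v) : Integrable (E.interimSurplus v N.q) E.prior := by
  refine ((integrable_grossSurplus hv hN.isRule).sub (hN.integrable_rent hreg hinv hv)).congr ?_
  filter_upwards [ae_prior_mem] with γ hγ
  exact (interimSurplus_eq hv hN.isRule hγ).symm

theorem RelaxedFeasible.relaxedProfit_eq {N : RelaxedMechanism n} (hN : E.RelaxedFeasible v N)
    (hreg : E.Regular) (hinv : E.InvariantDependencies) (hv : E.IsOrthogonalization v) :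
    E.relaxedProfit N = (∫ γ, E.interimSurplus v N.q γ ∂E.prior) - relaxedUtility v N E.lo := by
  obtain ⟨hm, hU⟩ := hN.relaxedUtility_eq hreg hinv hv
  obtain ⟨hi, hval⟩ := integral_prior_primitive hm
  have hgross := integrable_grossSurplus hv hN.isRule
  have h1 : E.relaxedProfit N = ∫ γ, (grossSurplus v N.q γ -
      (relaxedUtility v N E.lo + ∫ s in E.lo..γ, E.rentSlope v N.q s)) ∂E.prior := by
    refine integral_congr_ae ?_
    filter_upwards [ae_prior_mem] with γ hγ
    rw [← hU γ hγ, relaxedUtility, grossSurplus]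
    ring
  have h2 : ∫ γ, E.interimSurplus v N.q γ ∂E.prior = ∫ γ, (grossSurplus v N.q γ -
      E.rentSlope v N.q γ * ((1 - E.G γ) / E.g γ)) ∂E.prior := by
    refine integral_congr_ae ?_
    filter_upwards [ae_prior_mem] with γ hγ using interimSurplus_eq hv hN.isRule hγ
  have hU' : Integrable (fun γ => relaxedUtility v N E.lo +
      ∫ s in E.lo..γ, E.rentSlope v N.q s) E.prior := (integrable_const _).add hi
  rw [h1, h2, integral_sub hgross hU',
    integral_add (integrable_const _) hi, hval, integral_sub hgross
    (hN.integrable_rent hreg hinv hv), integral_prior fun γ => _ * _,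
    setIntegral_congr_fun measurableSet_Γ fun γ hγ => g_mul_div_g hγ _]
  simp only [integral_const, probReal_univ, one_smul]
  ring

/-! ### From the original to the relaxed problem -/

theorem integral_law (hv : E.IsOrthogonalization v) {γ : ℝ} (hγ : γ ∈ E.Γ)
    {h : (Fin n → ℝ) → ℝ} (hm : AEStronglyMeasurable h (E.law γ)) :
    ∫ θ, h θ ∂(E.law γ) = ∫ z, h (v γ z) ∂(unif n) := by
  rw [← hv.map_unif γ hγ] at hm ⊢
  exact integral_map (hv.measurable_apply γ).aemeasurable hm

theorem ae_law_mem_Θ {γ : ℝ} : ∀ᵐ θ ∂(E.law γ), θ ∈ E.Θ :=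
  ae_law_mem_Θint.mono fun _ h => E.Θint_subset_Θ h

theorem objective_eq (hv : E.IsOrthogonalization v) {q : ℝ → (Fin n → ℝ) → (Fin n → ℝ)}
    (hq : Measurable (Function.uncurry q)) :
    E.objective q = ∫ γ, E.interimSurplus v (fun γ z => q γ (v γ z)) γ ∂E.prior := by
  refine integral_congr_ae ?_
  filter_upwards [ae_prior_mem] with γ hγ
  refine integral_law hv hγ (h := fun θ => ∑ j, q γ θ j * E.virtualValue j γ (θ j)) ?_
  have hm : Measurable fun θ : Fin n → ℝ =>
      ∑ j, q γ θ j * (θ j - E.impulse j γ (θ j) * ((1 - E.G γ) / E.g γ)) :=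
    Finset.measurable_fun_sum _ fun j _ =>
      ((measurable_pi_apply j).comp hq.of_uncurry_left).mul ((measurable_pi_apply j).sub
        (((measurable_impulse j γ).comp (measurable_pi_apply j)).mul_const _))
  refine hm.aestronglyMeasurable.congr ?_
  filter_upwards [ae_law_mem_Θ] with θ hθ
  exact Finset.sum_congr rfl fun j _ => by rw [virtualValue_eq hγ (E.mem_Θ.1 hθ j)]

section Feasible

variable {M : Mechanism n}

theorem integral_iSup_payoff {γ γ' : ℝ} (h : ∀ θ ∈ E.Θ, ∀ θ' ∈ E.Θ,
      M.q γ' θ' ⬝ᵥ θ - M.t₂ γ' θ' ≤ M.q γ' θ ⬝ᵥ θ - M.t₂ γ' θ) :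
    ∫ θ, (⨆ θ' : E.Θ, (M.q γ' θ' ⬝ᵥ θ - M.t₁ γ' - M.t₂ γ' θ')) ∂(E.law γ) =
      ∫ θ, (M.q γ' θ ⬝ᵥ θ - M.t₁ γ' - M.t₂ γ' θ) ∂(E.law γ) := by
  refine integral_congr_ae (ae_law_mem_Θ.mono fun θ hθ => ?_)
  have hle : ∀ θ' : E.Θ, M.q γ' θ' ⬝ᵥ θ - M.t₁ γ' - M.t₂ γ' θ' ≤
      M.q γ' θ ⬝ᵥ θ - M.t₁ γ' - M.t₂ γ' θ := fun θ' => by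
    have := h θ hθ θ' θ'.2
    linarith
  have : Nonempty E.Θ := ⟨⟨θ, hθ⟩⟩
  exact le_antisymm (ciSup_le hle)
    (le_ciSup (f := fun θ' : E.Θ => M.q γ' θ' ⬝ᵥ θ - M.t₁ γ' - M.t₂ γ' θ')
      ⟨_, by rintro _ ⟨θ', rfl⟩; exact hle θ'⟩ ⟨θ, hθ⟩)

theorem Feasible.isRule_induced (hM : E.Feasible M) (hv : E.IsOrthogonalization v) :
    E.IsRule (M.induced v).q :=
  ⟨hM.measurable_q.comp (measurable_fst.prodMk hv.measurable),
    fun γ hγ z hz j => hM.q_mem γ hγ _ (hv.mapsTo γ hγ z hz) j⟩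

theorem Feasible.measurable_payoff (hM : E.Feasible M) (γ : ℝ) :
    Measurable fun θ => M.q γ θ ⬝ᵥ θ - M.t₁ γ - M.t₂ γ θ :=
  ((Finset.measurable_fun_sum _ fun j _ => ((measurable_pi_apply j).comp
    hM.measurable_q.of_uncurry_left).mul (measurable_pi_apply j)).sub_const _).sub
    hM.measurable_t₂.of_uncurry_left

/-- The transfers `t₂` of a feasible mechanism are bounded, since the allocation and the valuations
are. -/
theorem Feasible.integrable_t₂ (hM : E.Feasible M) (hv : E.IsOrthogonalization v) {γ γ' : ℝ}
    (hγ : γ ∈ E.Γ) (hγ' : γ' ∈ E.Γ) : Integrable (fun z => M.t₂ γ' (v γ z)) (unif n) := by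
  have hle : ∀ θ ∈ E.Θ, ∀ θ' ∈ E.Θ, M.t₂ γ' θ - M.t₂ γ' θ' ≤ ∑ j, max |E.a j| |E.b j| := by
    intro θ hθ θ' hθ'
    have h := hM.ic2 γ' hγ' θ hθ θ' hθ'
    have h2 : M.q γ' θ ⬝ᵥ θ - M.q γ' θ' ⬝ᵥ θ ≤ ∑ j, max |E.a j| |E.b j| := by
      rw [dotProduct, dotProduct, ← Finset.sum_sub_distrib]
      refine Finset.sum_le_sum fun j _ => ?_
      have hq := hM.q_mem γ' hγ' θ hθ j
      have hq' := hM.q_mem γ' hγ' θ' hθ' j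
      have hθj := E.mem_Θ.1 hθ j
      rw [← sub_mul]
      refine (le_abs_self _).trans ?_
      rw [abs_mul]
      refine (mul_le_of_le_one_left (abs_nonneg _) (abs_le.2 ⟨?_, ?_⟩)).trans
        (abs_le_max_abs_abs hθj.1 hθj.2)
      · linarith [hq.1, hq'.2]
      · linarith [hq.2, hq'.1]
    linarith
  have ha : E.a ∈ E.Θ := left_mem_Icc.2 fun j => (E.a_lt_b j).le
  refine Integrable.of_bound (C := |M.t₂ γ' E.a| + ∑ j, max |E.a j| |E.b j|)
    (hM.measurable_t₂.of_uncurry_left.comp (hv.measurable_apply γ)).aestronglyMeasurable ?_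
  filter_upwards [ae_mem_cube] with z hz
  have hθ := hv.mapsTo γ hγ z hz
  have h1 := hle _ hθ _ ha
  have h2 := hle _ ha _ hθ
  have h3 := abs_le.1 (le_refl |M.t₂ γ' E.a|)
  rw [Real.norm_eq_abs, abs_le]
  exact ⟨by linarith, by linarith⟩

theorem Feasible.integrable_dotProduct (hM : E.Feasible M) (hv : E.IsOrthogonalization v)
    {γ γ' : ℝ} (hγ : γ ∈ E.Γ) (hγ' : γ' ∈ E.Γ) :
    Integrable (fun z => M.q γ' (v γ z) ⬝ᵥ v γ z) (unif n) := by
  refine integrable_finsetSum _ fun j _ => (integrable_valuation hv hγ j).bdd_mul (c := 1)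
    ((measurable_pi_apply j).comp (hM.measurable_q.of_uncurry_left.comp
      (hv.measurable_apply γ))).aestronglyMeasurable ?_
  filter_upwards [ae_mem_cube] with z hz
  have := hM.q_mem γ' hγ' _ (hv.mapsTo γ hγ z hz) j
  rw [Real.norm_of_nonneg this.1]
  exact this.2

theorem Feasible.interimUtility_eq (hM : E.Feasible M) (hv : E.IsOrthogonalization v)
    {γ : ℝ} (hγ : γ ∈ E.Γ) : E.interimUtility M γ = relaxedUtility v (M.induced v) γ := by
  rw [interimUtility, integral_law hv hγ (hM.measurable_payoff γ).aestronglyMeasurable,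
    relaxedUtility]
  have hi : Integrable (fun z => M.t₁ γ + M.t₂ γ (v γ z)) (unif n) :=
    (integrable_const _).add (hM.integrable_t₂ hv hγ hγ)
  simp only [Mechanism.induced]
  rw [← integral_sub (hM.integrable_dotProduct hv hγ hγ) hi]
  exact integral_congr_ae (.of_forall fun z => sub_sub _ _ _)

/-- With the shock public, the buyer can imitate only the reports `v(γ', z)`, which he could also
send when the shock is private. -/
theorem Feasible.relaxedFeasible_induced (hM : E.Feasible M) (hv : E.IsOrthogonalization v) :
    E.RelaxedFeasible v (M.induced v) where
  measurable_q := (hM.isRule_induced hv).measurable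
  measurable_t := by
    have hm : Measurable (Function.uncurry fun γ z => M.t₁ γ + M.t₂ γ (v γ z)) :=
      (hM.measurable_t₁.comp measurable_fst).add
        (hM.measurable_t₂.comp (measurable_fst.prodMk hv.measurable))
    exact (hm.stronglyMeasurable.integral_prod_right (ν := unif n)).measurable
  q_mem := (hM.isRule_induced hv).mem
  ic γ hγ γ' hγ' := by
    have hi : Integrable (fun z => M.t₁ γ' + M.t₂ γ' (v γ' z)) (unif n) :=
      (integrable_const _).add (hM.integrable_t₂ hv hγ' hγ')
    have hd : Integrable (fun z => (M.induced v).q γ' z ⬝ᵥ v γ z) (unif n) :=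
      (hM.isRule_induced hv).integrable_dotProduct hv hγ hγ'
    have hu := hM.interimUtility_eq hv hγ
    rw [relaxedUtility] at hu
    have h := hM.ic1 γ hγ γ' hγ'
    rw [integral_iSup_payoff (hM.ic2 γ hγ), integral_iSup_payoff (hM.ic2 γ' hγ'),
      integral_law hv hγ (hM.measurable_payoff γ').aestronglyMeasurable] at h
    rw [← hu]
    refine le_trans ?_ h
    have ht : (M.induced v).t γ' = ∫ z, (M.t₁ γ' + M.t₂ γ' (v γ' z)) ∂(unif n) := rfl
    rw [ht, ← integral_sub hd hi]
    refine integral_mono_ae (hd.sub hi) (((hM.integrable_dotProduct hv hγ hγ').sub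
      (integrable_const _)).sub (hM.integrable_t₂ hv hγ hγ')) ?_
    filter_upwards [ae_mem_cube] with z hz
    have := hM.ic2 γ' hγ' _ (hv.mapsTo γ hγ z hz) _ (hv.mapsTo γ' hγ' z hz)
    simp only [Mechanism.induced]
    linarith
  ir γ hγ := by
    have hu := hM.interimUtility_eq hv hγ
    rw [relaxedUtility] at hu
    exact (hM.ir γ hγ).trans_eq hu

theorem Feasible.relaxedProfit_induced (hM : E.Feasible M) (hv : E.IsOrthogonalization v) :
    E.relaxedProfit (M.induced v) = E.profit M := by
  refine integral_congr_ae ?_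
  filter_upwards [ae_prior_mem] with γ hγ
  exact (integral_law hv hγ (h := fun θ => M.t₁ γ + M.t₂ γ θ)
    (measurable_const.add hM.measurable_t₂.of_uncurry_left).aestronglyMeasurable).symm

end Feasible

/-! ### Posted prices -/

variable (E) in
/-- The price of good `j` in the menu for `γ`: the lowest valuation with nonnegative virtual value,
and the highest valuation if there is none. -/
def price (j : Fin n) (γ : ℝ) : ℝ :=
  sInf ({x ∈ Ioo (E.a j) (E.b j) | 0 ≤ E.virtualValue j (E.clipΓ γ) x} ∪ {E.b j})

theorem bddBelow_price (j : Fin n) (γ : ℝ) : E.a j ∈ lowerBounds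
    ({x ∈ Ioo (E.a j) (E.b j) | 0 ≤ E.virtualValue j (E.clipΓ γ) x} ∪ {E.b j}) := by
  rintro x (hx | rfl)
  · exact hx.1.1.le
  · exact (E.a_lt_b j).le

theorem price_mem (j : Fin n) (γ : ℝ) : E.price j γ ∈ Icc (E.a j) (E.b j) :=
  ⟨le_csInf ⟨_, Or.inr rfl⟩ (bddBelow_price j γ), csInf_le ⟨_, bddBelow_price j γ⟩ (Or.inr rfl)⟩

theorem price_le_iff (hreg : E.Regular) {j : Fin n} {γ x : ℝ} (hγ : γ ∈ E.Γ)
    (hx : x ∈ Ioo (E.a j) (E.b j)) : E.price j γ ≤ x ↔ 0 ≤ E.virtualValue j γ x := by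
  have hclip := E.clipΓ_of_mem hγ
  refine ⟨fun h => ?_, fun h => csInf_le ⟨_, bddBelow_price j γ⟩ (Or.inl ⟨hx, hclip.symm ▸ h⟩)⟩
  by_contra! hneg
  -- the virtual value stays negative slightly above `x`, and single crossing clears all below
  have hcont : ContinuousAt (fun y => y - E.impulse j γ y * ((1 - E.G γ) / E.g γ)) x := by
    have h1 : ContinuousAt (E.margH j γ) x := ((E.continuous_margH j).uncurry_left γ).continuousAt
    have h2 : ContinuousAt (E.margP j γ) x := ((E.continuous_margP j).uncurry_left γ).continuousAt
    exact continuousAt_id.sub ((h1.div h2 (E.margP_pos γ hx).ne').neg.mul continuousAt_const)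
  have hev : ∀ᶠ y in 𝓝[>] x, E.virtualValue j γ y < 0 ∧ y ∈ Ioo x (E.b j) := by
    rw [virtualValue_eq hγ (Ioo_subset_Icc_self hx)] at hneg
    filter_upwards [nhdsWithin_le_nhds (hcont.eventually_lt continuousAt_const hneg),
      Ioo_mem_nhdsGT hx.2] with y hy hyx
    rw [virtualValue_eq hγ ⟨(hx.1.trans hyx.1).le, hyx.2.le⟩]
    exact ⟨hy, hyx⟩
  obtain ⟨y, hy, hyx⟩ := hev.exists
  refine absurd h (not_le.2 (hyx.1.trans_le (le_csInf ⟨_, Or.inr rfl⟩ ?_)))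
  rintro w (hw | rfl)
  · by_contra! hwy
    have hw2 := hw.2
    rw [hclip] at hw2
    exact absurd (hreg.singleCrossing j γ hγ w hw.1 y ⟨hx.1.trans hyx.1, hyx.2⟩ hwy.le hw2)
      hy.not_ge
  · exact hyx.2.le

theorem antitone_price (hreg : E.Regular) (j : Fin n) : Antitone (E.price j) := by
  intro γ γ' h
  refine csInf_le_csInf ⟨_, bddBelow_price j γ'⟩ ⟨_, Or.inr rfl⟩ (union_subset_union_left _ ?_)
  rintro x ⟨hx, hφ⟩
  exact ⟨hx, hφ.trans (hreg.monotone j x hx (E.clipΓ_mem _) (E.clipΓ_mem _)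
    (monotone_projIcc E.lo_lt_hi.le h))⟩

variable (E) in
/-- The rent that type `γ` earns on good `j` under the posted prices. -/
def postedRent (j : Fin n) (γ : ℝ) : ℝ := ∫ s in E.lo..γ, E.callSlope j s (E.price j s)

variable (E) in
/-- The menu of posted prices: after paying the entrance fee `t₁ γ`, a buyer who reported `γ`
may buy every good `j` at the price `price j γ`. -/
def posted : Mechanism n where
  q γ θ j := if E.price j γ ≤ θ j then 1 else 0
  t₁ γ := ∑ j, (E.callValue j (E.clipΓ γ) (E.price j γ) - E.postedRent j (E.clipΓ γ))
  t₂ γ θ := ∑ j, E.price j γ * if E.price j γ ≤ θ j then 1 else 0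

theorem intervalIntegrable_callSlope_price (hreg : E.Regular) (j : Fin n) (c d : ℝ) :
    IntervalIntegrable (fun s => E.callSlope j s (E.price j s)) volume c d := by
  obtain ⟨K, hK⟩ := (isCompact_uIcc.prod isCompact_Icc).exists_bound_of_continuousOn
    (s := uIcc c d ×ˢ Icc (E.a j) (E.b j)) (continuous_callSlope j).continuousOn
  have hm : Measurable fun s => E.callSlope j s (E.price j s) :=
    (continuous_callSlope j).measurable.comp
      (measurable_id.prodMk (antitone_price hreg j).measurable)
  rw [intervalIntegrable_iff]
  refine Measure.integrableOn_of_bounded (M := K) (by simp [uIoc]) hm.aestronglyMeasurable ?_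
  filter_upwards [ae_restrict_mem measurableSet_uIoc] with s hs
  exact hK (s, E.price j s) ⟨uIoc_subset_uIcc hs, price_mem j s⟩

theorem callSlope_antitoneOn (hreg : E.Regular) (j : Fin n) {s : ℝ} (hs : s ∈ E.Γ) :
    AntitoneOn (E.callSlope j s) (Icc (E.a j) (E.b j)) := by
  intro p hp p' hp' hpp'
  have hi : ∀ c d, IntervalIntegrable (fun y => -E.margH j s y) volume c d := fun c d =>
    ((E.continuous_margH j).uncurry_left s).neg.intervalIntegrable _ _
  rw [callSlope, callSlope, ← intervalIntegral.integral_add_adjacent_intervals (hi p p') (hi p' _)]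
  exact le_add_of_nonneg_left (intervalIntegral.integral_nonneg hpp' fun y hy =>
    neg_nonneg.2 (hreg.margH_nonpos hs ⟨hp.1.trans hy.1, hy.2.trans hp'.2⟩))

theorem callSlope_nonneg (hreg : E.Regular) (j : Fin n) {s p : ℝ} (hs : s ∈ E.Γ)
    (hp : p ∈ Icc (E.a j) (E.b j)) : 0 ≤ E.callSlope j s p :=
  intervalIntegral.integral_nonneg hp.2 fun _ hy =>
    neg_nonneg.2 (hreg.margH_nonpos hs ⟨hp.1.trans hy.1, hy.2⟩)

/-- The incentive constraint between two types, good by good. Prices fall in the type, so the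
slope of the expected surplus at the reported price is a lower bound for the slope of the rent above
the reported type, and an upper bound below it. -/
theorem callValue_sub_le (hreg : E.Regular) (j : Fin n) {γ γ' : ℝ} (hγ : γ ∈ E.Γ)
    (hγ' : γ' ∈ E.Γ) :
    E.callValue j γ (E.price j γ') - E.callValue j γ' (E.price j γ') ≤
      E.postedRent j γ - E.postedRent j γ' := by
  have hi := intervalIntegrable_callSlope_price hreg j
  have hc : ∀ c d, IntervalIntegrable (fun s => E.callSlope j s (E.price j γ')) volume c d :=
    fun c d => ((continuous_callSlope j).uncurry_right _).intervalIntegrable _ _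
  rw [callValue_sub j hγ' hγ, postedRent, postedRent,
    intervalIntegral.integral_interval_sub_left (hi _ _) (hi _ _)]
  rcases le_total γ' γ with h | h
  · refine intervalIntegral.integral_mono_on h (hc _ _) (hi _ _) fun s hs => ?_
    exact callSlope_antitoneOn hreg j ⟨hγ'.1.trans hs.1, hs.2.trans hγ.2⟩ (price_mem j s)
      (price_mem j γ') (antitone_price hreg j hs.1)
  · rw [intervalIntegral.integral_symm, intervalIntegral.integral_symm γ γ', neg_le_neg_iff]
    refine intervalIntegral.integral_mono_on h (hi _ _) (hc _ _) fun s hs => ?_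
    exact callSlope_antitoneOn hreg j ⟨hγ.1.trans hs.1, hs.2.trans hγ'.2⟩ (price_mem j γ')
      (price_mem j s) (antitone_price hreg j hs.2)

theorem posted_dotProduct_sub (γ : ℝ) (θ θ' : Fin n → ℝ) : E.posted.q γ θ' ⬝ᵥ θ - E.posted.t₂ γ θ' =
    ∑ j, (if E.price j γ ≤ θ' j then θ j - E.price j γ else 0) := by
  simp only [posted, dotProduct, ← Finset.sum_sub_distrib]
  refine Finset.sum_congr rfl fun j _ => ?_
  split_ifs <;> ring

theorem posted_payoff (γ : ℝ) (θ : Fin n → ℝ) : E.posted.q γ θ ⬝ᵥ θ - E.posted.t₂ γ θ =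
    ∑ j, max (θ j - E.price j γ) 0 := by
  rw [posted_dotProduct_sub]
  refine Finset.sum_congr rfl fun j _ => ?_
  split_ifs with h
  · rw [max_eq_left (sub_nonneg.2 h)]
  · rw [max_eq_right (sub_nonpos.2 (not_le.1 h).le)]

theorem posted_ic2 (γ : ℝ) (θ θ' : Fin n → ℝ) :
    E.posted.q γ θ' ⬝ᵥ θ - E.posted.t₂ γ θ' ≤ E.posted.q γ θ ⬝ᵥ θ - E.posted.t₂ γ θ := by
  rw [posted_payoff, posted_dotProduct_sub]
  refine Finset.sum_le_sum fun j _ => ?_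
  split_ifs
  exacts [le_max_left _ _, le_max_right _ _]

/-- The payoff of type `γ` who reports `γ'` and buys optimally afterwards. -/
theorem integral_posted_payoff (hv : E.IsOrthogonalization v) {γ γ' : ℝ} (hγ : γ ∈ E.Γ)
    (hγ' : γ' ∈ E.Γ) :
    ∫ θ, (E.posted.q γ' θ ⬝ᵥ θ - E.posted.t₁ γ' - E.posted.t₂ γ' θ) ∂(E.law γ) =
      ∑ j, (E.callValue j γ (E.price j γ') - E.callValue j γ' (E.price j γ') +
        E.postedRent j γ') := by
  have h : ∀ θ, E.posted.q γ' θ ⬝ᵥ θ - E.posted.t₁ γ' - E.posted.t₂ γ' θ =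
      (∑ j, max (θ j - E.price j γ') 0) - E.posted.t₁ γ' := fun θ => by
    rw [← posted_payoff]; ring
  have hi : ∀ j, Integrable (fun z => max (v γ z j - E.price j γ') 0) (unif n) := fun j =>
    ((integrable_valuation hv hγ j).sub (integrable_const _)).sup (integrable_zero _ _ _)
  simp_rw [h]
  rw [integral_law hv hγ (h := fun θ => (∑ j, max (θ j - E.price j γ') 0) - E.posted.t₁ γ')
    (by fun_prop : Continuous fun θ : Fin n → ℝ =>
      (∑ j, max (θ j - E.price j γ') 0) - E.posted.t₁ γ').aestronglyMeasurable,
    integral_sub (integrable_finsetSum _ fun j _ => hi j) (integrable_const _),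
    integral_finsetSum _ fun j _ => hi j]
  simp only [integral_max_valuation hv hγ (price_mem _ γ'), integral_const, probReal_univ, one_smul,
    posted, E.clipΓ_of_mem hγ', ← Finset.sum_sub_distrib]
  exact Finset.sum_congr rfl fun j _ => by ring

theorem measurable_posted_q (hreg : E.Regular) : Measurable (Function.uncurry E.posted.q) := by
  refine measurable_pi_iff.2 fun j => Measurable.ite ?_ measurable_const measurable_const
  exact measurableSet_le ((antitone_price hreg j).measurable.comp measurable_fst)
    ((measurable_pi_apply j).comp measurable_snd)

theorem feasible_posted (hreg : E.Regular) (hv : E.IsOrthogonalization v) :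
    E.Feasible E.posted where
  measurable_q := measurable_posted_q hreg
  measurable_t₁ := by
    have h1 : ∀ j, Measurable fun γ => E.callValue j (E.clipΓ γ) (E.price j γ) := fun j =>
      (continuous_callValue j).measurable.comp
        (E.continuous_clipΓ.measurable.prodMk (antitone_price hreg j).measurable)
    have h2 : ∀ j, Measurable fun γ => E.postedRent j (E.clipΓ γ) := fun j =>
      ((intervalIntegral.continuous_primitive
        (intervalIntegrable_callSlope_price hreg j) E.lo).comp E.continuous_clipΓ).measurable
    have h : Measurable fun γ =>
        ∑ j, (E.callValue j (E.clipΓ γ) (E.price j γ) - E.postedRent j (E.clipΓ γ)) :=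
      Finset.measurable_fun_sum _ fun j _ => (h1 j).sub (h2 j)
    exact h
  measurable_t₂ := by
    have h : Measurable fun p : ℝ × (Fin n → ℝ) =>
        ∑ j, E.price j p.1 * Function.uncurry E.posted.q p j :=
      Finset.measurable_fun_sum _ fun j _ => ((antitone_price hreg j).measurable.comp
        measurable_fst).mul ((measurable_pi_apply j).comp (measurable_posted_q hreg))
    exact h
  q_mem γ hγ θ hθ j := by
    simp only [posted]
    split_ifs <;> simp
  ic1 γ hγ γ' hγ' := by
    rw [integral_iSup_payoff fun θ _ θ' _ => posted_ic2 γ' θ θ',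
      integral_iSup_payoff fun θ _ θ' _ => posted_ic2 γ θ θ', integral_posted_payoff hv hγ hγ',
      integral_posted_payoff hv hγ hγ]
    refine Finset.sum_le_sum fun j _ => ?_
    have := callValue_sub_le hreg j hγ hγ'
    linarith
  ic2 γ _ θ _ θ' _ := posted_ic2 γ θ θ'
  ir γ hγ := by
    rw [integral_posted_payoff hv hγ hγ]
    refine Finset.sum_nonneg fun j _ => ?_
    rw [sub_self, zero_add, postedRent]
    exact intervalIntegral.integral_nonneg hγ.1 fun s hs =>
      callSlope_nonneg hreg j ⟨hs.1, hs.2.trans hγ.2⟩ (price_mem j s)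

theorem interimUtility_posted_lo (hv : E.IsOrthogonalization v) :
    E.interimUtility E.posted E.lo = 0 := by
  rw [interimUtility, integral_posted_payoff hv E.lo_mem E.lo_mem]
  simp [postedRent]

theorem posted_q_eq_one (hreg : E.Regular) {γ : ℝ} (hγ : γ ∈ E.Γ) {θ : Fin n → ℝ}
    (hθ : θ ∈ E.Θint) {j : Fin n} (h : 0 ≤ E.virtualValue j γ (θ j)) : E.posted.q γ θ j = 1 :=
  if_pos ((price_le_iff hreg hγ (hθ j)).2 h)

theorem posted_q_eq_zero (hreg : E.Regular) {γ : ℝ} (hγ : γ ∈ E.Γ) {θ : Fin n → ℝ}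
    (hθ : θ ∈ E.Θint) {j : Fin n} (h : E.virtualValue j γ (θ j) < 0) : E.posted.q γ θ j = 0 :=
  if_neg fun hp => h.not_ge ((price_le_iff hreg hγ (hθ j)).1 hp)

/-! ### Optimality and uniqueness -/

/-- The posted allocation maximizes the virtual surplus good by good. -/
theorem mul_virtualValue_le_posted (hreg : E.Regular) {γ : ℝ} (hγ : γ ∈ E.Γ) {θ : Fin n → ℝ}
    (hθ : θ ∈ E.Θint) (j : Fin n) {x : ℝ} (hx : x ∈ Icc (0 : ℝ) 1) :
    x * E.virtualValue j γ (θ j) ≤ E.posted.q γ θ j * E.virtualValue j γ (θ j) := by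
  rcases le_or_gt 0 (E.virtualValue j γ (θ j)) with h | h
  · rw [posted_q_eq_one hreg hγ hθ h]
    exact mul_le_mul_of_nonneg_right hx.2 h
  · rw [posted_q_eq_zero hreg hγ hθ h, zero_mul]
    exact mul_nonpos_of_nonneg_of_nonpos hx.1 h.le

theorem interimSurplus_le_posted (hreg : E.Regular) (hinv : E.InvariantDependencies)
    (hv : E.IsOrthogonalization v) {q : ℝ → (Fin n → ℝ) → (Fin n → ℝ)} (hq : E.IsRule q) {γ : ℝ}
    (hγ : γ ∈ E.Γ) : E.interimSurplus v q γ ≤ E.interimSurplus v (E.posted.induced v).q γ := by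
  refine integral_mono_ae
    (integrable_finsetSum _ fun j _ => hq.integrable_mul hγ j (integrable_virtualValue hv hγ j))
    (integrable_finsetSum _ fun j _ => ((feasible_posted hreg hv).isRule_induced hv).integrable_mul
      hγ j (integrable_virtualValue hv hγ j)) ?_
  filter_upwards [ae_interior hinv hv, ae_mem_cube] with z hz hz'
  exact Finset.sum_le_sum fun j _ =>
    mul_virtualValue_le_posted hreg hγ (hz.2 γ hγ) j (hq.mem γ hγ z hz' j)

theorem relaxedUtility_posted_lo (hreg : E.Regular) (hv : E.IsOrthogonalization v) :
    relaxedUtility v (E.posted.induced v) E.lo = 0 := by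
  rw [← (feasible_posted hreg hv).interimUtility_eq hv E.lo_mem, interimUtility_posted_lo hv]

theorem isRelaxedOptimal_posted (hreg : E.Regular) (hinv : E.InvariantDependencies)
    (hv : E.IsOrthogonalization v) : E.IsRelaxedOptimal v (E.posted.induced v) := by
  have hP := (feasible_posted hreg hv).relaxedFeasible_induced hv
  refine ⟨hP, fun N hN => ?_⟩
  rw [hN.relaxedProfit_eq hreg hinv hv, hP.relaxedProfit_eq hreg hinv hv,
    relaxedUtility_posted_lo hreg hv]
  refine sub_le_sub (integral_mono_ae (hN.integrable_interimSurplus hreg hinv hv)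
    (hP.integrable_interimSurplus hreg hinv hv) ?_) (hN.ir E.lo E.lo_mem)
  filter_upwards [ae_prior_mem] with γ hγ
  exact interimSurplus_le_posted hreg hinv hv hN.isRule hγ

theorem isOptimal_posted (hreg : E.Regular) (hinv : E.InvariantDependencies)
    (hv : E.IsOrthogonalization v) : E.IsOptimal E.posted := by
  have hP := feasible_posted hreg hv
  refine ⟨hP, fun M hM => ?_⟩
  rw [← hM.relaxedProfit_induced hv, ← hP.relaxedProfit_induced hv]
  exact (isRelaxedOptimal_posted hreg hinv hv).2 _ (hM.relaxedFeasible_induced hv)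

theorem IsOptimal.profit_eq {M : Mechanism n} (hM : E.IsOptimal M) (hreg : E.Regular)
    (hinv : E.InvariantDependencies) (hv : E.IsOrthogonalization v) :
    E.profit M = E.relaxedProfit (E.posted.induced v) := by
  have hP := isOptimal_posted hreg hinv hv
  rw [hP.1.relaxedProfit_induced hv]
  exact le_antisymm (hP.2 M hM.1) (hM.2 _ hP.1)

theorem IsRelaxedOptimal.relaxedProfit_eq {N : RelaxedMechanism n} (hN : E.IsRelaxedOptimal v N)
    (hreg : E.Regular) (hinv : E.InvariantDependencies) (hv : E.IsOrthogonalization v) :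
    E.relaxedProfit N = E.relaxedProfit (E.posted.induced v) := by
  have hP := isRelaxedOptimal_posted hreg hinv hv
  exact le_antisymm (hP.2 N hN.1) (hN.2 _ hP.1)

theorem isOptimal_iff {M : Mechanism n} (hM : E.Feasible M) (hreg : E.Regular)
    (hinv : E.InvariantDependencies) (hv : E.IsOrthogonalization v) :
    E.IsOptimal M ↔ E.IsRelaxedOptimal v (M.induced v) := by
  have hP := isRelaxedOptimal_posted hreg hinv hv
  refine ⟨fun h => ⟨hM.relaxedFeasible_induced hv, fun N hN => ?_⟩, fun h => ⟨hM, fun M' hM' => ?_⟩⟩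
  · rw [hM.relaxedProfit_induced hv, h.profit_eq hreg hinv hv]
    exact hP.2 N hN
  · rw [← hM.relaxedProfit_induced hv, ← hM'.relaxedProfit_induced hv]
    exact h.2 _ (hM'.relaxedFeasible_induced hv)

/-- A solution of the relaxed problem leaves the lowest type no rent and, ties and null sets aside,
has the posted allocation. -/
theorem IsRelaxedOptimal.eq_posted {N : RelaxedMechanism n} (hN : E.IsRelaxedOptimal v N)
    (hreg : E.Regular) (hinv : E.InvariantDependencies) (hv : E.IsOrthogonalization v) :
    relaxedUtility v N E.lo = 0 ∧ ∀ᵐ γ ∂E.prior, ∀ᵐ z ∂(unif n), ∀ j,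
      E.virtualValue j γ (v γ z j) ≠ 0 → N.q γ z j = E.posted.q γ (v γ z) j := by
  have hP := (feasible_posted hreg hv).relaxedFeasible_induced hv
  have hprofit := hN.relaxedProfit_eq hreg hinv hv
  rw [hN.1.relaxedProfit_eq hreg hinv hv, hP.relaxedProfit_eq hreg hinv hv,
    relaxedUtility_posted_lo hreg hv, sub_zero] at hprofit
  have hiN := hN.1.integrable_interimSurplus hreg hinv hv
  have hiP := hP.integrable_interimSurplus hreg hinv hv
  have hle : E.interimSurplus v N.q ≤ᵐ[E.prior] E.interimSurplus v (E.posted.induced v).q := by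
    filter_upwards [ae_prior_mem] with γ hγ
    exact interimSurplus_le_posted hreg hinv hv hN.1.isRule hγ
  have hir : 0 ≤ relaxedUtility v N E.lo := hN.1.ir E.lo E.lo_mem
  have hmono := integral_mono_ae hiN hiP hle
  refine ⟨by linarith, ?_⟩
  have hae := (integral_eq_iff_of_ae_le hiN hiP hle).1 (by linarith)
  filter_upwards [hae, ae_prior_mem] with γ hγe hγ
  have hzle : (fun z => ∑ j, N.q γ z j * E.virtualValue j γ (v γ z j)) ≤ᵐ[unif n]
      fun z => ∑ j, (E.posted.induced v).q γ z j * E.virtualValue j γ (v γ z j) := by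
    filter_upwards [ae_interior hinv hv, ae_mem_cube] with z hz hz'
    exact Finset.sum_le_sum fun j _ =>
      mul_virtualValue_le_posted hreg hγ (hz.2 γ hγ) j (hN.1.q_mem γ hγ z hz' j)
  have hzae := (integral_eq_iff_of_ae_le
    (integrable_finsetSum _ fun j _ => hN.1.isRule.integrable_mul hγ j
      (integrable_virtualValue hv hγ j))
    (integrable_finsetSum _ fun j _ => hP.isRule.integrable_mul hγ j
      (integrable_virtualValue hv hγ j)) hzle).1 hγe
  filter_upwards [hzae, ae_interior hinv hv, ae_mem_cube] with z hz hint hcube j hj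
  exact mul_right_cancel₀ hj ((Finset.sum_eq_sum_iff_of_le fun j _ =>
    mul_virtualValue_le_posted hreg hγ (hint.2 γ hγ) j (hN.1.q_mem γ hγ z hcube j)).1 hz j
      (Finset.mem_univ j))

/-- Solutions of the relaxed problem with almost everywhere equal allocations have almost everywhere
equal transfers: the allocation determines the rents up to that of the lowest type. -/
theorem IsRelaxedOptimal.transfer_ae_eq {N N' : RelaxedMechanism n}
    (hN : E.IsRelaxedOptimal v N) (hN' : E.IsRelaxedOptimal v N') (hreg : E.Regular)
    (hinv : E.InvariantDependencies) (hv : E.IsOrthogonalization v)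
    (h : ∀ᵐ γ ∂E.prior, ∀ᵐ z ∂(unif n), N.q γ z = N'.q γ z) :
    ∀ᵐ γ ∂E.prior, N.t γ = N'.t γ := by
  have hslope : ∀ᵐ s ∂(volume.restrict E.Γ), E.rentSlope v N.q s = E.rentSlope v N'.q s := by
    filter_upwards [ae_prior_iff.1 h] with s hs
    exact integral_congr_ae (hs.mono fun z hz => by simp only [hz])
  filter_upwards [h, ae_prior_mem] with γ hγe hγ
  have hU := (hN.1.relaxedUtility_eq hreg hinv hv).2 γ hγ
  have hU' := (hN'.1.relaxedUtility_eq hreg hinv hv).2 γ hγ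
  have hint : ∫ s in E.lo..γ, E.rentSlope v N.q s = ∫ s in E.lo..γ, E.rentSlope v N'.q s := by
    refine intervalIntegral.integral_congr_ae ?_
    rw [uIoc_of_le hγ.1]
    filter_upwards [(ae_restrict_iff' measurableSet_Γ).1 hslope] with s hs hsm
    exact hs ⟨hsm.1.le, hsm.2.trans hγ.2⟩
  have hgross : ∫ z, N.q γ z ⬝ᵥ v γ z ∂(unif n) = ∫ z, N'.q γ z ⬝ᵥ v γ z ∂(unif n) :=
    integral_congr_ae (hγe.mono fun z hz => by simp only [hz])
  rw [(hN.eq_posted hreg hinv hv).1, hint] at hU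
  rw [(hN'.eq_posted hreg hinv hv).1, ← hU, relaxedUtility, relaxedUtility, hgross] at hU'
  linarith

end Env

end Screening

end

theorem proposition3 {n : ℕ} (E : Screening.Env n) (hreg : E.Regular)
    (hinv : E.InvariantDependencies) (v : ℝ → (Fin n → ℝ) → (Fin n → ℝ))
    (hv : E.IsOrthogonalization v) :
    -- the impulse response at `z` with `v(γ, z) = θ` is the marginal term, up to sign
    (∀ γ ∈ E.Γ, ∀ θ ∈ E.Θint, ∀ z ∈ Screening.openCube n, v γ z = θ → ∀ j,
      HasDerivWithinAt (fun s => v s z j)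
        (-(E.margCdfDeriv j γ (θ j) / E.margDens j γ (θ j))) E.Γ γ) ∧
    -- profits are the virtual surplus less the rent of the lowest type, in both problems
    (∀ M, E.Feasible M → E.profit M = E.objective M.q - E.interimUtility M E.lo) ∧
    (∀ M, E.RelaxedFeasible v M → E.relaxedProfit M = E.relaxedObjective v M.q -
      ((∫ z, M.q E.lo z ⬝ᵥ v E.lo z ∂(Screening.unif n)) - M.t E.lo)) ∧
    -- the two objectives agree
    (∀ q : ℝ → (Fin n → ℝ) → (Fin n → ℝ), Measurable (Function.uncurry q) →
      (∀ γ ∈ E.Γ, ∀ θ ∈ E.Θ, ∀ j, q γ θ j ∈ Set.Icc (0 : ℝ) 1) →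
      E.relaxedObjective v (fun γ z => q γ (v γ z)) = E.objective q) ∧
    -- the pointwise optimal allocation rule solves both problems
    (∃ M, E.IsOptimal M ∧ E.IsRelaxedOptimal v (M.induced v) ∧
      ∀ γ ∈ E.Γ, ∀ θ ∈ E.Θint, ∀ j,
        (0 ≤ E.virtualValue j γ (θ j) → M.q γ θ j = 1) ∧
        (E.virtualValue j γ (θ j) < 0 → M.q γ θ j = 0)) ∧
    -- a feasible mechanism yields the same profit in both problems, and solves one iff the other
    (∀ M, E.Feasible M → E.relaxedProfit (M.induced v) = E.profit M ∧
      (E.IsOptimal M ↔ E.IsRelaxedOptimal v (M.induced v))) ∧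
    -- optimal profits agree, and so do optimal allocations, up to ties and null sets
    (∀ M N, E.IsOptimal M → E.IsRelaxedOptimal v N →
      E.relaxedProfit N = E.profit M ∧
      ∀ᵐ γ ∂E.prior, ∀ᵐ z ∂(Screening.unif n), ∀ j,
        E.virtualValue j γ (v γ z j) ≠ 0 → N.q γ z j = M.q γ (v γ z) j) ∧
    -- without ties, the solutions agree, transfers included, up to null sets
    ((∀ᵐ γ ∂E.prior, ∀ᵐ θ ∂(E.law γ), ∀ j, E.virtualValue j γ (θ j) ≠ 0) →
      ∀ M N, E.IsOptimal M → E.IsRelaxedOptimal v N →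
        ∀ᵐ γ ∂E.prior, (∀ᵐ z ∂(Screening.unif n), N.q γ z = M.q γ (v γ z)) ∧
          N.t γ = (M.induced v).t γ) := by
  have hopt : ∀ {M N}, E.IsOptimal M → E.IsRelaxedOptimal v N →
      ∀ᵐ γ ∂E.prior, ∀ᵐ z ∂(Screening.unif n), ∀ j,
        E.virtualValue j γ (v γ z j) ≠ 0 → N.q γ z j = M.q γ (v γ z) j := by
    intro M N hM hN
    have hMr := (Screening.Env.isOptimal_iff hM.1 hreg hinv hv).1 hM
    filter_upwards [(hN.eq_posted hreg hinv hv).2, (hMr.eq_posted hreg hinv hv).2] with γ h1 h2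
    filter_upwards [h1, h2] with z h1 h2 j hj
    rw [h1 j hj, ← h2 j hj]
    rfl
  refine ⟨?_, ?_, ?_, ?_, ⟨E.posted, ?_, ?_, ?_⟩, ?_, ?_, ?_⟩
  · rintro γ hγ θ hθ z hz rfl j
    have hj := Set.Ioo_subset_Icc_self (hθ j)
    rw [E.margCdfDeriv_eq hγ hj, E.margDens_eq hγ hj]
    exact Screening.Env.hasDerivWithinAt_valuation hinv hv hγ hz hθ j
  · intro M hM
    rw [← hM.relaxedProfit_induced hv, Screening.Env.objective_eq hv hM.measurable_q,
      hM.interimUtility_eq hv E.lo_mem]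
    exact (hM.relaxedFeasible_induced hv).relaxedProfit_eq hreg hinv hv
  · intro M hM
    rw [Screening.Env.relaxedObjective_eq hinv hv]
    exact hM.relaxedProfit_eq hreg hinv hv
  · intro q hq _
    rw [Screening.Env.relaxedObjective_eq hinv hv, Screening.Env.objective_eq hv hq]
  · exact Screening.Env.isOptimal_posted hreg hinv hv
  · exact Screening.Env.isRelaxedOptimal_posted hreg hinv hv
  · exact fun γ hγ θ hθ j => ⟨Screening.Env.posted_q_eq_one hreg hγ hθ,
      Screening.Env.posted_q_eq_zero hreg hγ hθ⟩
  · exact fun M hM => ⟨hM.relaxedProfit_induced hv,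
      Screening.Env.isOptimal_iff hM hreg hinv hv⟩
  · exact fun M N hM hN => ⟨(hN.relaxedProfit_eq hreg hinv hv).trans
      (hM.profit_eq hreg hinv hv).symm, hopt hM hN⟩
  · intro hties M N hM hN
    have hq : ∀ᵐ γ ∂E.prior, ∀ᵐ z ∂(Screening.unif n), N.q γ z = (M.induced v).q γ z := by
      filter_upwards [hopt hM hN, hties, Screening.Env.ae_prior_mem] with γ h1 h2 hγ
      rw [← hv.map_unif γ hγ] at h2
      filter_upwards [h1, MeasureTheory.ae_of_ae_map (hv.measurable_apply γ).aemeasurable h2]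
        with z h1 h2
      exact funext fun j => h1 j (h2 j)
    have hMr := (Screening.Env.isOptimal_iff hM.1 hreg hinv hv).1 hM
    filter_upwards [hq, hN.transfer_ae_eq hMr hreg hinv hv hq] with γ h1 h2
    exact ⟨h1, h2⟩
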